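/- **Conventions.** Let $G$ be a simple graph on a finite vertex set $V$, $|V|=n$; vectors $x\in\mathbb R^V$ are real functions on $V$, with the Euclidean norm. A *fiber* of $x$ is a set $\{i: x_i=\alpha\}$ with $\alpha\in\mathbb R$. An *acyclic orientation* of $G$ directs every edge of $G$ in exactly one way, without directed cycles. It is *transitive* if any two different vertices $u,v$ are adjacent in $G$ exactly when there is a directed path from $u$ to $v$ or from $v$ to $u$. $G$ is a *comparability graph* if some partial order on $V$ has the property that two different vertices are adjacent iff they are comparable. A vector $x$ *induces* the (possibly partial) orientation $O_x$ of $G$ which directs an edge $\{i,j\}$ from $i$ to $j$ if $x_i<x_j$, and leaves it undirected if $x_i=x_j$. For an acyclic orientation $O$, $C_O$ is the closure in $\mathbb R^V$ of the region $\{x : x_i\ne x_j \text{ for every edge } \{i,j\},\ O_x=O\}$ of the graphical arrangement of $G$. A *module* of $G$ is a set $A\subseteq V$ all of whose elements have the same neighbours outside $A$; it is *proper* if $A\neq V$ and *connected* if $G[A]$ is connected. Disjoint sets $X,Y\subseteq V$ are *completely adjacent* if every $i\in X$ and $j\in Y$ are adjacent. For connected $G$ with complement $\overline G$, the *canonical partition*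 $\mathcal P$ consists of the (non-empty) inclusion-maximal proper modules of $G$ if $\overline G$ is connected, and of the vertex sets of the connected components of $\overline G$ if $\overline G$ is disconnected (for $n=1$ this means $\mathcal P=\emptyset$). The *copartition subgraph* $G^{\mathcal P}$ is obtained from $G$ by deleting all edges with both ends in the same block of $\mathcal P$. **Theorem 3.1.** Let $G$ be a connected comparability graph with canonical partition $\mathcal P$. Let $\lambda_{\max}$ be the largest eigenvalue of the Laplacian matrix of $G$ and $E_{\max}\subseteq\mathbb R^V$ its eigenspace. Then: * **i.** If $O$ is a transitive orientation of $G$, then the linear span of $C_O\cap E_{\max}$ has dimension $\dim E_{\max}$. * **ii.** $E_{\max}\subseteq\bigcup_O C_O$, the union being over all transitive orientations $O$ of $G$. * **iii.** Let $x$ be chosen uniformly at random from the unit sphere $\{y\in E_{\max}:\|y\|=1\}$. Almost surely: 1. every $A\in\mathcal P$ is contained in a fiber of $x$; 2. if $A,A'\in\mathcal P$ are completely adjacent in $G$, then $A$ and $A'$ are contained in different fibers of $x$; 3. $x$ induces a transitive orientation of $G^{\mathcal P}$; in particular, $G^{\mathcal P}$ is a comparability graph; 4. every transitive orientation of $G^{\mathcal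 P}$ is induced by $x$ with positive probability; 5. for every fiber $\xi$ of $x$, $G[\xi]$ is the disjoint union $G[B_1]+\dots+G[B_k]$ for some $k\ge 0$ and some connected modules $B_1,\dots,B_k$ of $G$ such that every $G[B_i]$ is a comparability graph; 6. if $n\ge 2$: $G$ has exactly two transitive orientations if and only if $\dim E_{\max}=1$ and every fiber of $x$ is an independent set of $G$. * **iv.** If $\overline G$ is connected, then $\dim E_{\max}=1$. If $\overline G$ is disconnected, then $\dim E_{\max}$ is the number of connected components of $\overline G$ minus one. -/

import Mathlib

open MeasureTheory

namespace TopLap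

noncomputable section

variable {V : Type*}

/-! ### Laplacian eigenspace of the largest eigenvalue -/

/-- The Laplacian matrix of `G`, acting on Euclidean space indexed by the vertices. -/
def lapOp [Fintype V] [DecidableEq V] (G : SimpleGraph V) [DecidableRel G.Adj] :
    EuclideanSpace ℝ V →ₗ[ℝ] EuclideanSpace ℝ V :=
  Matrix.toEuclideanLin (G.lapMatrix ℝ)

/-- The largest eigenvalue of the Laplacian of `G`. -/
def lamMax [Fintype V] [DecidableEq V] (G : SimpleGraph V) [DecidableRel G.Adj] : ℝ :=
  sSup {a : ℝ | Module.End.HasEigenvalue (lapOp G) a}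

/-- The supremum in `lamMax` is a maximum. -/
theorem isGreatest_lamMax [Fintype V] [DecidableEq V] [Nonempty V] (G : SimpleGraph V)
    [DecidableRel G.Adj] :
    IsGreatest {a : ℝ | Module.End.HasEigenvalue (lapOp G) a} (lamMax G) := by
  have hfin : {a : ℝ | Module.End.HasEigenvalue (lapOp G) a}.Finite :=
    Module.End.finite_hasEigenvalue (lapOp G)
  have hsym : (lapOp G).IsSymmetric := by
    rw [lapOp, Matrix.isSymmetric_toEuclideanLin_iff]
    exact (SimpleGraph.posSemidef_lapMatrix ℝ G).1
  have hne : {a : ℝ | Module.End.HasEigenvalue (lapOp G) a}.Nonempty :=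
    ⟨_, hsym.hasEigenvalue_iSup_of_finiteDimensional⟩
  exact ⟨hne.csSup_mem hfin, fun a ha => le_csSup hfin.bddAbove ha⟩

/-- The eigenspace of the Laplacian of `G` for its largest eigenvalue. -/
def topEigenspace [Fintype V] [DecidableEq V] (G : SimpleGraph V) [DecidableRel G.Adj] :
    Submodule ℝ (EuclideanSpace ℝ V) :=
  Module.End.eigenspace (lapOp G) (lamMax G)

/-! ### Orientations, graphical arrangement, cones

A (partial) orientation of a graph is identified with its set of directed edges, i.e. with a
relation `O` on the vertices: `O i j` says that the edge `{i, j}` is directed from `i` to `j`;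
an edge which `O` relates in neither direction is left undirected. -/

/-- `O` is an acyclic orientation of `G`: it directs exactly the edges of `G`, every one of them,
and it has no directed cycle (in particular no edge is directed both ways). -/
structure IsAcyclicOrientation (G : SimpleGraph V) (O : V → V → Prop) : Prop where
  adj : ∀ i j, O i j → G.Adj i j
  total : ∀ i j, G.Adj i j → O i j ∨ O j i
  acyclic : ∀ i, ¬ Relation.TransGen O i i

/-- `O` is a transitive orientation of `G`: an acyclic orientation such that the comparability
graph of the partial order "there is a directed path from `u` to `v`" is `G`. -/
def IsTransitiveOrientation (G : SimpleGraph V) (O : V → V → Prop) : Prop :=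
  IsAcyclicOrientation G O ∧
    ∀ u v, u ≠ v → ((Relation.TransGen O u v ∨ Relation.TransGen O v u) ↔ G.Adj u v)

/-- Comparability graphs: two different vertices are adjacent iff they are comparable in
some partial order on the vertices. -/
def IsComparabilityGraph (G : SimpleGraph V) : Prop :=
  ∃ P : PartialOrder V, ∀ u v, u ≠ v → (G.Adj u v ↔ (P.le u v ∨ P.le v u))

/-- The orientation of `G` induced by the vector `x`: an edge points to its endpoint with
the larger value (and is left undirected if the two values agree). -/
def inducedOrientation (G : SimpleGraph V) (x : EuclideanSpace ℝ V) : V → V → Prop :=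
  fun i j => G.Adj i j ∧ x i < x j

/-- The graphical arrangement of `G`, the union of the hyperplanes `x i = x j` over the edges. -/
def graphicalArrangement (G : SimpleGraph V) : Set (EuclideanSpace ℝ V) :=
  {x | ∃ i j, G.Adj i j ∧ x i = x j}

/-- The region of the graphical arrangement which corresponds to the orientation `O`: the points
off the arrangement which induce `O`. -/
def region (G : SimpleGraph V) (O : V → V → Prop) : Set (EuclideanSpace ℝ V) :=
  {x | x ∉ graphicalArrangement G ∧ inducedOrientation G x = O}

/-- The closed cone of the orientation `O`, the closure of its region. -/
def cone [Fintype V] (G : SimpleGraph V) (O : V → V → Prop) : Set (EuclideanSpace ℝ V) :=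
  closure (region G O)

/-! ### Modules and the canonical partition -/

/-- The open neighbourhood of a set of vertices. -/
def openNbhd (G : SimpleGraph V) (X : Set V) : Set V :=
  {j | j ∉ X ∧ ∃ i ∈ X, G.Adj i j}

/-- Modules of `G`. -/
def IsModule (G : SimpleGraph V) (A : Set V) : Prop :=
  ∀ i ∈ A, ∀ j ∈ A, openNbhd G {i} \ A = openNbhd G {j} \ A ∧
    openNbhd G {j} \ A = openNbhd G A

/-- Modules which induce a connected (in particular nonempty) subgraph. -/
def IsConnectedModule (G : SimpleGraph V) (A : Set V) : Prop :=
  IsModule G A ∧ (G.induce A).Connected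

/-- Two disjoint sets of vertices with all possible edges between them. -/
def CompletelyAdjacent (G : SimpleGraph V) (X Y : Set V) : Prop :=
  X ∩ Y = ∅ ∧ ∀ i ∈ X, ∀ j ∈ Y, G.Adj i j

/-- The canonical partition of a connected graph `G`: the (nonempty) maximal proper modules if the
complement is connected, the vertex sets of the components of the complement otherwise. -/
def canonicalPartition (G : SimpleGraph V) : Set (Set V) :=
  {A | (Gᶜ.Connected ∧ A.Nonempty ∧ Maximal (fun B => IsModule G B ∧ B ≠ Set.univ) A) ∨
    (¬ Gᶜ.Connected ∧ ∃ c : Gᶜ.ConnectedComponent, A = c.supp)}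

/-- The copartition subgraph of `G`: the edges inside the blocks of the canonical partition are
removed. -/
def copartition (G : SimpleGraph V) : SimpleGraph V where
  Adj i j := G.Adj i j ∧ ¬ ∃ A ∈ canonicalPartition G, i ∈ A ∧ j ∈ A
  symm := ⟨fun _ _ h => ⟨h.1.symm, fun ⟨A, hA, hj, hi⟩ => h.2 ⟨A, hA, hi, hj⟩⟩⟩
  loopless := ⟨fun _ h => h.1.ne rfl⟩

/-- `F` is a fiber of the vector `x`. -/
def IsFiber (x : EuclideanSpace ℝ V) (F : Set V) : Prop :=
  ∃ a : ℝ, ∀ i, x i = a ↔ i ∈ F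

/-- The induced subgraph on `F` is the disjoint union of the induced subgraphs on the sets `B i`. -/
def IsDisjointUnion {k : ℕ} (G : SimpleGraph V) (F : Set V) (B : Fin k → Set V) : Prop :=
  (F = ⋃ i, B i) ∧ ∀ i j, i ≠ j → Disjoint (B i) (B j) ∧ ∀ u ∈ B i, ∀ v ∈ B j, ¬ G.Adj u v

/-- The uniform probability measure on the unit sphere of a (nonzero) subspace `W`: the
normalized surface measure. -/
def uniformUnit [Fintype V] (W : Submodule ℝ (EuclideanSpace ℝ V)) :
    Measure (Metric.sphere (0 : W) 1) :=
  ((volume : Measure W).toSphere Set.univ)⁻¹ • (volume : Measure W).toSphere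

end

end TopLap

/-! The Laplacian `L` maps the cone of a transitive orientation `O` into itself. Along an arc from
`i` to `j`, the difference of the entries of `L x` at `j` and `i` splits into one term per vertex
`k`, and transitivity makes each term nonnegative (`lapOp_term_nonneg`). Normalized powers of `L +
1` converge to the projection onto the top eigenspace `E`, so this projection also preserves the
closed cone. As the cone spans the whole space, its intersection with `E` spans `E`
(`span_cone_inter`).

If the ends of an edge have equal entries in some `x` of the cone and of `E`, all these terms
vanish. Hence a vertex outside the fiber cannot distinguish the ends, and the components of a fiber
are modules (`isModule_image_supp`). Conversely, vectors of `E` are constant on the blocks of the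
canonical partition (`eq_of_mem_block`).

If the complement is connected, a nonzero vector of `E` in the cone therefore separates every edge
of the copartition subgraph. Subtracting multiples of one such vector from any other vector of `E`
until a difference vanishes shows that `E` is a line. If the complement is disconnected, the
Laplacians of `G` and its complement add up to `n I - J`, and `E` consists of the zero-sum vectors
constant on the components of the complement.

In both cases a vector of `E` outside finitely many proper subspaces separates the edges of the
copartition subgraph and orients it transitively. Such orientations extend to `G` because blocks are
modules (`substitute`), and closedness of the cones yields the covering of all of `E`
(`exists_mem_cone`). -/

namespace TopLap

/-! ### Transitive orientations -/

section Orientations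

variable {V : Type*} {G H : SimpleGraph V} {O O' : V → V → Prop}

/-- A transitive orientation is a transitive relation whose symmetrization is adjacency. -/
theorem isTransitiveOrientation_iff :
    IsTransitiveOrientation G O ↔
      (∀ u v, G.Adj u v ↔ O u v ∨ O v u) ∧ ∀ u v w, O u v → O v w → O u w := by
  constructor
  · rintro ⟨⟨h1, h2, h3⟩, h4⟩
    refine ⟨fun u v => ⟨h2 u v, fun h => h.elim (h1 _ _) fun h => (h1 _ _ h).symm⟩, ?_⟩
    intro u v w huv hvw
    have huw : Relation.TransGen O u w := (Relation.TransGen.single huv).tail hvw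
    have hne : u ≠ w := by
      rintro rfl
      exact h3 _ huw
    rcases h2 u w ((h4 u w hne).1 (Or.inl huw)) with h | h
    · exact h
    · exact absurd (huw.tail h) (h3 u)
  · rintro ⟨h1, h2⟩
    have hT : ∀ u v, Relation.TransGen O u v → O u v := by
      intro u v h
      induction h with
      | single h => exact h
      | tail _ h ih => exact h2 _ _ _ ih h
    refine ⟨⟨fun i j h => (h1 i j).2 (Or.inl h), fun i j h => (h1 i j).1 h,
      fun i h => ((h1 i i).2 (Or.inl (hT _ _ h))).ne rfl⟩, fun u v _ => ?_⟩
    rw [h1]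
    exact or_congr ⟨hT _ _, .single⟩ ⟨hT _ _, .single⟩

namespace IsTransitiveOrientation

theorem adj_iff (h : IsTransitiveOrientation G O) (u v : V) : G.Adj u v ↔ O u v ∨ O v u :=
  (isTransitiveOrientation_iff.1 h).1 u v

theorem trans (h : IsTransitiveOrientation G O) {u v w : V} (huv : O u v) (hvw : O v w) : O u w :=
  (isTransitiveOrientation_iff.1 h).2 u v w huv hvw

theorem adj (h : IsTransitiveOrientation G O) {u v : V} (huv : O u v) : G.Adj u v :=
  (h.adj_iff u v).2 (Or.inl huv)

theorem irrefl (h : IsTransitiveOrientation G O) (u : V) : ¬ O u u :=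
  fun h' => (h.adj h').ne rfl

theorem asymm (h : IsTransitiveOrientation G O) {u v : V} (huv : O u v) : ¬ O v u :=
  fun h' => h.irrefl u (h.trans huv h')

/-- The reversal of a transitive orientation is transitive. -/
theorem reverse (h : IsTransitiveOrientation G O) :
    IsTransitiveOrientation G (fun u v => O v u) :=
  isTransitiveOrientation_iff.2
    ⟨fun u v => (h.adj_iff u v).trans or_comm, fun _ _ _ h1 h2 => h.trans h2 h1⟩

theorem reverse_ne (h : IsTransitiveOrientation G O) {u v : V} (huv : G.Adj u v) :
    O ≠ fun u v => O v u := by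
  intro heq
  rcases (h.adj_iff u v).1 huv with h' | h'
  · exact h.asymm h' (by rw [heq] at h'; exact h')
  · exact h.asymm h' (by rw [heq] at h'; exact h')

theorem isComparabilityGraph (h : IsTransitiveOrientation G O) : IsComparabilityGraph G := by
  refine ⟨{ le := fun u v => u = v ∨ O u v, le_refl := fun u => Or.inl rfl,
            le_trans := ?_, le_antisymm := ?_ }, fun u v huv => ?_⟩
  · rintro u v w (rfl | h1) (rfl | h2)
    exacts [Or.inl rfl, Or.inr h2, Or.inr h1, Or.inr (h.trans h1 h2)]
  · rintro u v (rfl | h1) (h2 | h2)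
    exacts [rfl, rfl, h2.symm, absurd h2 (h.asymm h1)]
  · change G.Adj u v ↔ (u = v ∨ O u v) ∨ (v = u ∨ O v u)
    simp [h.adj_iff, huv, huv.symm]

/-- Restriction of a transitive orientation to an induced subgraph. -/
theorem induce (h : IsTransitiveOrientation G O) (s : Set V) :
    IsTransitiveOrientation (G.induce s) (fun u v => O u v) :=
  isTransitiveOrientation_iff.2 ⟨fun u v => h.adj_iff u v, fun _ _ _ h1 h2 => h.trans h1 h2⟩

/-- If `S` is a partial equivalence relation whose classes are modules of `G`, a transitive
orientation of the edges inside the classes and one of the other edges can be combined. -/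
theorem substitute {S : V → V → Prop} (hsymm : ∀ u v, S u v → S v u)
    (htrans : ∀ u v w, S u v → S v w → S u w)
    (hmod : ∀ u v w, S u v → ¬ S u w → (G.Adj u w ↔ G.Adj v w))
    (hH : ∀ u v, H.Adj u v ↔ G.Adj u v ∧ ¬ S u v)
    (hO : IsTransitiveOrientation G O) (hO' : IsTransitiveOrientation H O') :
    IsTransitiveOrientation G (fun u v => O' u v ∨ (S u v ∧ O u v)) := by
  have key : ∀ u v w, H.Adj u v → S v w → H.Adj u w := by
    intro u v w huv hvw
    have h1 := (hH u v).1 huv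
    have h2 : ¬ S v u := fun h => h1.2 (hsymm _ _ h)
    exact (hH u w).2 ⟨((hmod v w u hvw h2).1 h1.1.symm).symm,
      fun h => h1.2 (htrans _ _ _ h (hsymm _ _ hvw))⟩
  refine isTransitiveOrientation_iff.2 ⟨fun u v => ?_, ?_⟩
  · constructor
    · intro h
      by_cases hS : S u v
      · rcases (hO.adj_iff u v).1 h with h' | h'
        · exact Or.inl (Or.inr ⟨hS, h'⟩)
        · exact Or.inr (Or.inr ⟨hsymm _ _ hS, h'⟩)
      · rcases (hO'.adj_iff u v).1 ((hH u v).2 ⟨h, hS⟩) with h' | h'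
        · exact Or.inl (Or.inl h')
        · exact Or.inr (Or.inl h')
    · rintro ((h | h) | (h | h))
      · exact ((hH _ _).1 (hO'.adj h)).1
      · exact hO.adj h.2
      · exact ((hH _ _).1 (hO'.adj h)).1.symm
      · exact (hO.adj h.2).symm
  · rintro u v w (h1 | ⟨h1, h1'⟩) (h2 | ⟨h2, h2'⟩)
    · exact Or.inl (hO'.trans h1 h2)
    -- The module property makes `u w` an edge of `H`. The wrong direction, from `w` to `u`, would
    -- give an arc of `H` from `w` to `v` inside a class.
    · rcases (hO'.adj_iff u w).1 (key u v w (hO'.adj h1) h2) with h | h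
      · exact Or.inl h
      · exact absurd (hsymm _ _ h2) ((hH _ _).1 (hO'.adj (hO'.trans h h1))).2
    · have h3 : H.Adj w u := key w v u (hO'.adj h2).symm (hsymm _ _ h1)
      rcases (hO'.adj_iff u w).1 h3.symm with h | h
      · exact Or.inl h
      · exact absurd (hsymm _ _ h1) ((hH _ _).1 (hO'.adj (hO'.trans h2 h))).2
    · exact Or.inr ⟨htrans _ _ _ h1 h2, hO.trans h1' h2'⟩

end IsTransitiveOrientation

/-- Comparability graphs are the graphs which have a transitive orientation. -/
theorem IsComparabilityGraph.exists_isTransitiveOrientation (h : IsComparabilityGraph G) :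
    ∃ O, IsTransitiveOrientation G O := by
  obtain ⟨P, hP⟩ := h
  refine ⟨fun u v => u ≠ v ∧ P.le u v, isTransitiveOrientation_iff.2 ⟨fun u v => ?_, ?_⟩⟩
  · by_cases huv : u = v
    · subst huv
      simp
    · simp [hP u v huv, huv, Ne.symm huv]
  · rintro u v w ⟨h1, h1'⟩ ⟨_, h2'⟩
    refine ⟨?_, P.le_trans _ _ _ h1' h2'⟩
    rintro rfl
    exact h1 (P.le_antisymm _ _ h1' h2')

theorem IsComparabilityGraph.induce (h : IsComparabilityGraph G) (s : Set V) :
    IsComparabilityGraph (G.induce s) := by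
  obtain ⟨O, hO⟩ := h.exists_isTransitiveOrientation
  exact (hO.induce s).isComparabilityGraph

/-- A vector induces `O` as soon as it is strictly increasing along `O`. -/
theorem IsTransitiveOrientation.inducedOrientation_eq (h : IsTransitiveOrientation G O)
    {x : EuclideanSpace ℝ V} (hx : ∀ i j, O i j → x i < x j) : inducedOrientation G x = O := by
  ext i j
  refine ⟨fun ⟨h1, h2⟩ => ?_, fun h1 => ⟨h.adj h1, hx i j h1⟩⟩
  rcases (h.adj_iff i j).1 h1 with h' | h'
  · exact h'
  · exact absurd (hx j i h') h2.asymm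

theorem IsTransitiveOrientation.mem_region_iff (h : IsTransitiveOrientation G O)
    {x : EuclideanSpace ℝ V} : x ∈ region G O ↔ ∀ i j, O i j → x i < x j := by
  constructor
  · rintro ⟨-, rfl⟩ i j hij
    exact hij.2
  · intro hx
    refine ⟨?_, h.inducedOrientation_eq hx⟩
    rintro ⟨i, j, hij, heq⟩
    rcases (h.adj_iff i j).1 hij with h' | h'
    · exact (hx i j h').ne heq
    · exact (hx j i h').ne heq.symm

theorem eq_of_forall_adj_eq (hG : G.Connected) {f : V → ℝ} (hf : ∀ u v, G.Adj u v → f u = f v)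
    (u v : V) : f u = f v := by
  obtain ⟨p⟩ := hG.preconnected u v
  induction p with
  | nil => rfl
  | cons h _ ih => exact (hf _ _ h).trans ih

/-! ### Regions and cones of transitive orientations -/

variable [Fintype V]

theorem IsTransitiveOrientation.region_nonempty (h : IsTransitiveOrientation G O) :
    (region G O).Nonempty := by
  classical
  -- The number of predecessors is strictly increasing along arcs: predecessors are inherited by
  -- transitivity, and `i` itself is a new one at `j`.
  refine ⟨WithLp.toLp 2 fun v => ((Finset.univ.filter fun k => O k v).card : ℝ),
    h.mem_region_iff.2 fun i j hij => ?_⟩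
  simp only [Nat.cast_lt]
  refine Finset.card_lt_card (Finset.ssubset_iff_of_subset ?_ |>.2 ⟨i, ?_, ?_⟩)
  · intro k hk
    simp only [Finset.mem_filter, Finset.mem_univ, true_and] at hk ⊢
    exact h.trans hk hij
  · simpa using hij
  · simpa using h.irrefl i

theorem IsTransitiveOrientation.isOpen_region (h : IsTransitiveOrientation G O) :
    IsOpen (region G O) := by
  have : region G O = ⋂ i, ⋂ j, {x : EuclideanSpace ℝ V | O i j → x i < x j} := by
    ext x
    simp [h.mem_region_iff]
  rw [this]
  refine isOpen_iInter_of_finite fun i => isOpen_iInter_of_finite fun j => ?_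
  by_cases hij : O i j
  · simp only [hij, forall_const]
    exact isOpen_lt (by fun_prop) (by fun_prop)
  · simp [hij]

/-- Adding a small positive multiple of a point of the region turns weak inequalities into strict
ones, so a weakly monotone vector is a limit of points of the region. -/
theorem IsTransitiveOrientation.mem_cone_iff (h : IsTransitiveOrientation G O)
    {x : EuclideanSpace ℝ V} : x ∈ cone G O ↔ ∀ i j, O i j → x i ≤ x j := by
  constructor
  · intro hx
    have hcl : IsClosed {x : EuclideanSpace ℝ V | ∀ i j, O i j → x i ≤ x j} := by
      simp only [Set.ofPred_forall]
      refine isClosed_iInter fun i => isClosed_iInter fun j => isClosed_iInter fun _ => ?_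
      exact isClosed_le (by fun_prop) (by fun_prop)
    exact closure_minimal (fun y hy i j hij => (h.mem_region_iff.1 hy i j hij).le) hcl hx
  · intro hx
    obtain ⟨y, hy⟩ := h.region_nonempty
    have hlim : Filter.Tendsto (fun e : ℝ => x + e • y) (nhdsWithin 0 (Set.Ioi 0)) (nhds x) := by
      have : Filter.Tendsto (fun e : ℝ => x + e • y) (nhds 0) (nhds (x + (0 : ℝ) • y)) :=
        Continuous.tendsto (by fun_prop) 0
      rw [zero_smul, add_zero] at this
      exact this.mono_left nhdsWithin_le_nhds
    refine mem_closure_of_tendsto hlim ?_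
    filter_upwards [self_mem_nhdsWithin] with e he
    refine h.mem_region_iff.2 fun i j hij => ?_
    have h1 := hx i j hij
    have h2 := mul_lt_mul_of_pos_left (h.mem_region_iff.1 hy i j hij) he
    simp only [PiLp.add_apply, PiLp.smul_apply, smul_eq_mul]
    linarith

theorem IsTransitiveOrientation.span_cone (h : IsTransitiveOrientation G O) :
    Submodule.span ℝ (cone G O) = ⊤ := by
  refine Submodule.eq_top_of_nonempty_interior' _ ?_
  obtain ⟨y, hy⟩ := h.region_nonempty
  exact ⟨y, mem_interior.2 ⟨region G O, subset_closure.trans Submodule.subset_span,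
    h.isOpen_region, hy⟩⟩

/-- On a connected graph the cone of a transitive orientation contains no lines apart from the
constant vectors. -/
theorem IsTransitiveOrientation.eq_of_mem_cone_of_neg_mem_cone (h : IsTransitiveOrientation G O)
    (hconn : G.Connected) {x : EuclideanSpace ℝ V} (h1 : x ∈ cone G O) (h2 : -x ∈ cone G O)
    (u v : V) : x u = x v := by
  have hadj : ∀ i j, G.Adj i j → x i = x j := by
    intro i j hij
    have key : ∀ i j, O i j → x i = x j := fun i j hij =>
      le_antisymm (h.mem_cone_iff.1 h1 i j hij) (by simpa using h.mem_cone_iff.1 h2 i j hij)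
    rcases (h.adj_iff i j).1 hij with h' | h'
    exacts [key _ _ h', (key _ _ h').symm]
  exact eq_of_forall_adj_eq hconn hadj u v

theorem IsTransitiveOrientation.mem_cone_reverse_iff (h : IsTransitiveOrientation G O)
    {x : EuclideanSpace ℝ V} : x ∈ cone G (fun u v => O v u) ↔ -x ∈ cone G O := by
  rw [h.reverse.mem_cone_iff, h.mem_cone_iff]
  constructor
  · intro hx i j hij
    simpa using hx j i hij
  · intro hx i j hij
    simpa using hx j i hij

end Orientations

/-! ### Power iteration for symmetric operators -/

section PowerIteration

open scoped InnerProductSpace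

variable {F : Type*} [NormedAddCommGroup F] [InnerProductSpace ℝ F] [FiniteDimensional ℝ F]
  {T : F →ₗ[ℝ] F}

theorem inner_apply_le_of_forall_eigenvalue_le (hT : T.IsSymmetric) {lam : ℝ}
    (h : ∀ a, Module.End.HasEigenvalue T a → a ≤ lam) (x : F) : ⟪x, T x⟫_ℝ ≤ lam * ⟪x, x⟫_ℝ := by
  set b := hT.eigenvectorBasis rfl with hb
  rw [← b.sum_inner_mul_inner x (T x), ← b.sum_inner_mul_inner x x, Finset.mul_sum]
  refine Finset.sum_le_sum fun k _ => ?_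
  have h1 : ⟪b k, T x⟫_ℝ = hT.eigenvalues rfl k * ⟪b k, x⟫_ℝ := by
    rw [← hT, hb, hT.apply_eigenvectorBasis, ← hb, real_inner_smul_left]
    rfl
  rw [h1, real_inner_comm x (b k)]
  have h2 : hT.eigenvalues rfl k ≤ lam := h _ (hT.hasEigenvalue_eigenvalues rfl k)
  nlinarith [mul_self_nonneg ⟪x, b k⟫_ℝ]

/-- The projection to the top eigenspace of a symmetric operator `T` with nonnegative eigenvalues
preserves every closed set which is preserved by `T + 1` and by positive scalars. -/
theorem exists_projection_eigenspace (hT : T.IsSymmetric) {lam : ℝ} (hlam : 0 ≤ lam)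
    (h : ∀ a, Module.End.HasEigenvalue T a → 0 ≤ a ∧ a ≤ lam) :
    ∃ P : F →ₗ[ℝ] F, (∀ x, P x ∈ Module.End.eigenspace T lam) ∧
      (∀ x ∈ Module.End.eigenspace T lam, P x = x) ∧
      ∀ C : Set F, IsClosed C → (∀ x ∈ C, T x + x ∈ C) → (∀ r : ℝ, 0 < r → ∀ x ∈ C, r • x ∈ C) →
        ∀ x ∈ C, P x ∈ C := by
  classical
  set b := hT.eigenvectorBasis rfl with hb
  set e := hT.eigenvalues (rfl : Module.finrank ℝ F = _) with he
  have hTb : ∀ k, T (b k) = e k • b k := fun k => by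
    rw [hb, hT.apply_eigenvectorBasis]
    rfl
  -- The eigenvalues of `S` lie in `(0, 1]`, with value 1 exactly on the top eigenspace, so the
  -- powers of `S` converge to the projection. The shift by 1 keeps the normalization meaningful
  -- when `lam = 0`.
  set S : F →ₗ[ℝ] F := (lam + 1)⁻¹ • (T + 1) with hS
  have hS' : ∀ x, S x = (lam + 1)⁻¹ • (T x + x) := fun x => by simp [hS]
  have hSb : ∀ k, S (b k) = ((e k + 1) / (lam + 1)) • b k := fun k => by
    rw [hS', hTb, div_eq_inv_mul, mul_smul, add_smul, one_smul]
  have hSN : ∀ N k, (S ^ N) (b k) = ((e k + 1) / (lam + 1)) ^ N • b k := by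
    intro N k
    induction N with
    | zero => simp
    | succ N ih => rw [pow_succ', Module.End.mul_apply, ih, map_smul, hSb, smul_smul, pow_succ]
  set P : F →ₗ[ℝ] F :=
    ∑ k, if e k = lam then (innerₛₗ ℝ (b k)).smulRight (b k) else 0 with hP
  have hPx : ∀ x, P x = ∑ k, (if e k = lam then (1 : ℝ) else 0) • ⟪b k, x⟫_ℝ • b k := by
    intro x
    rw [hP, LinearMap.sum_apply]
    refine Finset.sum_congr rfl fun k _ => ?_
    split_ifs <;> simp
  have hlim : ∀ x, Filter.Tendsto (fun N => (S ^ N) x) Filter.atTop (nhds (P x)) := by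
    intro x
    have hx : ∀ N, (S ^ N) x = ∑ k, ((e k + 1) / (lam + 1)) ^ N • ⟪b k, x⟫_ℝ • b k := by
      intro N
      conv_lhs => rw [← b.sum_repr' x]
      rw [map_sum]
      refine Finset.sum_congr rfl fun k _ => ?_
      rw [map_smul, hSN, smul_comm]
    rw [hPx]
    simp_rw [hx]
    refine tendsto_finsetSum _ fun k _ => Filter.Tendsto.smul_const ?_ _
    have hk := h _ (hT.hasEigenvalue_eigenvalues rfl k)
    change 0 ≤ e k ∧ e k ≤ lam at hk
    split_ifs with h1
    · rw [h1, div_self (by positivity)]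
      exact tendsto_const_nhds.congr fun N => (one_pow N).symm
    · refine tendsto_pow_atTop_nhds_zero_of_lt_one (div_nonneg (by linarith) (by linarith)) ?_
      rw [div_lt_one (by linarith)]
      linarith [lt_of_le_of_ne hk.2 h1]
  refine ⟨P, fun x => ?_, fun x hx => ?_, fun C hC hTC hrC x hx => ?_⟩
  · rw [hPx]
    refine Submodule.sum_mem _ fun k _ => ?_
    split_ifs with h1
    · refine Submodule.smul_mem _ _ (Submodule.smul_mem _ _ ?_)
      rw [Module.End.mem_eigenspace_iff, hTb, h1]
    · simp
  · have hfix : ∀ N, (S ^ N) x = x := by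
      intro N
      induction N with
      | zero => simp
      | succ N ih =>
        rw [pow_succ', Module.End.mul_apply, ih, hS', Module.End.mem_eigenspace_iff.1 hx]
        nth_rw 2 [← one_smul ℝ x]
        rw [← add_smul, smul_smul, inv_mul_cancel₀ (by linarith), one_smul]
    have := hlim x
    simp_rw [hfix] at this
    exact (tendsto_nhds_unique this tendsto_const_nhds)
  · refine hC.mem_of_tendsto (hlim x) (Filter.Eventually.of_forall fun N => ?_)
    induction N with
    | zero => simpa using hx
    | succ N ih =>
      rw [pow_succ', Module.End.mul_apply, hS']
      exact hrC _ (by positivity) _ (hTC _ ih)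

end PowerIteration

/-! ### The Laplacian and its top eigenspace -/

section Laplacian

variable {V : Type*} [Fintype V] [DecidableEq V] {G : SimpleGraph V} [DecidableRel G.Adj]
  {O : V → V → Prop} {x : EuclideanSpace ℝ V}

theorem lapOp_apply (x : EuclideanSpace ℝ V) (i : V) :
    lapOp G x i = ∑ k, if G.Adj i k then x i - x k else 0 := by
  have h : lapOp G x i = Matrix.mulVec (G.lapMatrix ℝ) x i := rfl
  rw [h, SimpleGraph.lapMatrix_mulVec_apply, SimpleGraph.degree_eq_sum_if_adj, Finset.sum_mul,
    SimpleGraph.neighborFinset_eq_filter, Finset.sum_filter, ← Finset.sum_sub_distrib]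
  refine Finset.sum_congr rfl fun k _ => ?_
  split_ifs <;> simp

theorem lapOp_isSymmetric : (lapOp G).IsSymmetric := by
  rw [lapOp, Matrix.isSymmetric_toEuclideanLin_iff]
  exact (SimpleGraph.posSemidef_lapMatrix ℝ G).1

theorem mem_topEigenspace_iff : x ∈ topEigenspace G ↔ ∀ i, lapOp G x i = lamMax G * x i := by
  rw [topEigenspace, Module.End.mem_eigenspace_iff]
  constructor
  · intro h i
    rw [h]
    rfl
  · intro h
    ext i
    exact h i

theorem sum_lapOp (x : EuclideanSpace ℝ V) : ∑ i, lapOp G x i = 0 := by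
  simp_rw [lapOp_apply]
  have h : ∑ i, ∑ k, (if G.Adj i k then x i - x k else 0) =
      - ∑ i, ∑ k, (if G.Adj i k then x i - x k else 0) := by
    conv_rhs => rw [Finset.sum_comm]
    simp_rw [← Finset.sum_neg_distrib]
    refine Finset.sum_congr rfl fun i _ => Finset.sum_congr rfl fun k _ => ?_
    by_cases hik : G.Adj i k
    · simp [hik, hik.symm]
    · have hki : ¬ G.Adj k i := fun h => hik h.symm
      simp [hik, hki]
  linarith

variable [Nonempty V]

theorem le_lamMax {a : ℝ} (h : Module.End.HasEigenvalue (lapOp G) a) : a ≤ lamMax G :=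
  (isGreatest_lamMax G).2 h

omit [Nonempty V] in
theorem eigenvalue_nonneg {a : ℝ} (h : Module.End.HasEigenvalue (lapOp G) a) : 0 ≤ a := by
  refine eigenvalue_nonneg_of_nonneg h fun y => ?_
  have := (SimpleGraph.posSemidef_lapMatrix ℝ G).dotProduct_mulVec_nonneg y
  simpa [PiLp.inner_apply, lapOp, Matrix.toLpLin_apply, dotProduct, mul_comm] using this

theorem sum_mul_lapOp_le (x : EuclideanSpace ℝ V) :
    ∑ i, x i * lapOp G x i ≤ lamMax G * ∑ i, x i * x i := by
  have := inner_apply_le_of_forall_eigenvalue_le (lapOp_isSymmetric (G := G))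
    (fun a ha => le_lamMax ha) x
  simpa only [PiLp.inner_apply, RCLike.inner_apply, conj_trivial, mul_comm] using this

theorem exists_ne_zero_mem_topEigenspace : ∃ x ∈ topEigenspace G, x ≠ 0 := by
  obtain ⟨x, hx⟩ := (isGreatest_lamMax G).1.exists_hasEigenvector
  exact ⟨x, hx.1, hx.2⟩

theorem finrank_topEigenspace_pos : 0 < Module.finrank ℝ (topEigenspace G) := by
  obtain ⟨x, hx, h0⟩ := exists_ne_zero_mem_topEigenspace (G := G)
  exact Module.finrank_pos_iff_exists_ne_zero.2 ⟨⟨x, hx⟩, by simpa using h0⟩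

theorem lamMax_pos {u v : V} (huv : G.Adj u v) : 0 < lamMax G := by
  set w : EuclideanSpace ℝ V := EuclideanSpace.single u 1 with hw
  have h := sum_mul_lapOp_le (G := G) w
  have h1 : ∑ i, w i * lapOp G w i = lapOp G w u := by
    rw [Finset.sum_eq_single u] <;> simp +contextual [hw]
  have h2 : ∑ i, w i * w i = 1 := by
    rw [Finset.sum_eq_single u] <;> simp +contextual [hw]
  rw [h1, h2, mul_one] at h
  refine lt_of_lt_of_le ?_ h
  rw [lapOp_apply]
  refine Finset.sum_pos' (fun k _ => ?_) ⟨v, Finset.mem_univ _, ?_⟩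
  · by_cases hk : u = k
    · subst hk; simp
    · simp only [hw, PiLp.single_apply, if_true, Ne.symm hk, if_false]
      split_ifs <;> norm_num
  · simp [hw, huv, huv.ne']

theorem sum_eq_zero_of_mem_topEigenspace {u v : V} (huv : G.Adj u v) (hx : x ∈ topEigenspace G) :
    ∑ i, x i = 0 := by
  have h := sum_lapOp (G := G) x
  simp_rw [mem_topEigenspace_iff.1 hx, ← Finset.mul_sum] at h
  exact (mul_eq_zero.1 h).resolve_left (lamMax_pos huv).ne'

/-- If `G` has an edge, the top eigenspace contains no nonzero constant vector. -/
theorem eq_zero_of_mem_topEigenspace_of_const {u v : V} (huv : G.Adj u v)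
    (hx : x ∈ topEigenspace G) (hconst : ∀ i j, x i = x j) : x = 0 := by
  have h := sum_eq_zero_of_mem_topEigenspace huv hx
  ext i
  simp_rw [fun j => hconst j i, Finset.sum_const, Finset.card_univ, nsmul_eq_mul] at h
  exact (mul_eq_zero.1 h).resolve_left (by simp)

omit [Nonempty V] [DecidableEq V] in
/-- Every summand of `(L x) j - (L x) i` is nonnegative if `x` is in the cone of a transitive
orientation which directs an edge from `i` to `j`. -/
theorem IsTransitiveOrientation.lapOp_term_nonneg (h : IsTransitiveOrientation G O)
    (hx : x ∈ cone G O) {i j : V} (hij : O i j) (k : V) :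
    0 ≤ (if G.Adj j k then x j - x k else 0) - (if G.Adj i k then x i - x k else 0) := by
  have hx := h.mem_cone_iff.1 hx
  have h1 := hx i j hij
  by_cases hj : G.Adj j k <;> by_cases hi : G.Adj i k
  · simp only [hi, hj, if_true]
    linarith
  · simp only [hi, hj, if_true, if_false]
    -- An arc from `j` to `k` would give one from `i` to `k` by transitivity. So a neighbour of `j`
    -- alone precedes `j`; symmetrically, a neighbour of `i` alone succeeds `i`.
    rcases (h.adj_iff j k).1 hj with h' | h'
    · exact absurd (h.adj (h.trans hij h')) hi
    · linarith [hx _ _ h']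
  · simp only [hi, hj, if_true, if_false]
    rcases (h.adj_iff i k).1 hi with h' | h'
    · linarith [hx _ _ h']
    · exact absurd (h.adj (h.trans h' hij)).symm hj
  · simp [hi, hj]

omit [Nonempty V] in
-- The Laplacian alone already preserves the cone, by the termwise estimate; the summand `x` is
-- there to match the shifted operator of the power iteration.
theorem IsTransitiveOrientation.lapOp_add_mem_cone (h : IsTransitiveOrientation G O)
    (hx : x ∈ cone G O) : lapOp G x + x ∈ cone G O := by
  refine h.mem_cone_iff.2 fun i j hij => ?_
  have h1 := h.mem_cone_iff.1 hx i j hij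
  have h2 : 0 ≤ lapOp G x j - lapOp G x i := by
    rw [lapOp_apply, lapOp_apply, ← Finset.sum_sub_distrib]
    exact Finset.sum_nonneg fun k _ => h.lapOp_term_nonneg hx hij k
  simp only [PiLp.add_apply]
  linarith

/-- The cone of a transitive orientation spans the top eigenspace. -/
theorem IsTransitiveOrientation.span_cone_inter (h : IsTransitiveOrientation G O) :
    Submodule.span ℝ (cone G O ∩ (topEigenspace G : Set (EuclideanSpace ℝ V))) =
      topEigenspace G := by
  obtain ⟨P, hP1, hP2, hP3⟩ := exists_projection_eigenspace (lapOp_isSymmetric (G := G))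
    (eigenvalue_nonneg (isGreatest_lamMax G).1) fun a ha => ⟨eigenvalue_nonneg ha, le_lamMax ha⟩
  have hPC : ∀ y ∈ cone G O, P y ∈ cone G O := by
    refine hP3 _ isClosed_closure (fun y hy => h.lapOp_add_mem_cone hy) fun r hr y hy => ?_
    refine h.mem_cone_iff.2 fun i j hij => ?_
    simpa using mul_le_mul_of_nonneg_left (h.mem_cone_iff.1 hy i j hij) hr.le
  refine le_antisymm (Submodule.span_le.2 Set.inter_subset_right) fun y hy => ?_
  -- `P` fixes `y` and the cone spans everything, so `y` is a combination of projected cone vectors,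
  -- which stay in the cone and lie in the eigenspace.
  have h1 : y ∈ (Submodule.span ℝ (cone G O)).map P := by
    rw [h.span_cone]
    exact ⟨y, trivial, hP2 y hy⟩
  rw [Submodule.map_span] at h1
  refine Submodule.span_mono ?_ h1
  rintro _ ⟨z, hz, rfl⟩
  exact ⟨hPC z hz, hP1 z⟩

omit [Nonempty V] in
/-- Edges inside a fiber of a top eigenvector from the cone of a transitive orientation are not
distinguished by vertices outside that fiber. -/
theorem IsTransitiveOrientation.eq_of_adj_of_not_adj (h : IsTransitiveOrientation G O)
    (hx : x ∈ cone G O) (hE : x ∈ topEigenspace G) {i j k : V} (hij : G.Adj i j)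
    (heq : x i = x j) (hi : G.Adj i k) (hj : ¬ G.Adj j k) : x k = x i := by
  -- This is a vanishing sum of terms of one sign, so each term is zero; the term at `k` is `x k - x
  -- i` up to sign.
  have hL : lapOp G x j - lapOp G x i = 0 := by
    rw [mem_topEigenspace_iff.1 hE, mem_topEigenspace_iff.1 hE, heq, sub_self]
  rw [lapOp_apply, lapOp_apply] at hL
  rcases (h.adj_iff i j).1 hij with h' | h'
  · rw [← Finset.sum_sub_distrib,
      Finset.sum_eq_zero_iff_of_nonneg fun k _ => h.lapOp_term_nonneg hx h' k] at hL
    have := hL k (Finset.mem_univ _)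
    simp only [hi, hj, if_true, if_false] at this
    linarith
  · rw [← neg_eq_zero, neg_sub, ← Finset.sum_sub_distrib,
      Finset.sum_eq_zero_iff_of_nonneg fun k _ => h.lapOp_term_nonneg hx h' k] at hL
    have := hL k (Finset.mem_univ _)
    simp only [hi, hj, if_true, if_false] at this
    linarith

end Laplacian

/-! ### Modules and the canonical partition -/

section Modules

variable {V : Type*} {G : SimpleGraph V}

theorem isModule_iff {A : Set V} :
    IsModule G A ↔ ∀ i ∈ A, ∀ j ∈ A, ∀ k ∉ A, G.Adj i k → G.Adj j k := by
  constructor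
  · intro h i hi j hj k hk hik
    have hk' : k ∈ openNbhd G {i} \ A :=
      ⟨⟨by simpa using hik.ne', i, rfl, hik⟩, hk⟩
    rw [(h i hi j hj).1] at hk'
    obtain ⟨⟨-, l, rfl, hl⟩, -⟩ := hk'
    exact hl
  · intro h
    have key : ∀ i ∈ A, openNbhd G {i} \ A = openNbhd G A := by
      intro i hi
      ext k
      constructor
      · rintro ⟨⟨-, l, rfl, hl⟩, hk⟩
        exact ⟨hk, l, hi, hl⟩
      · rintro ⟨hk, l, hl, hlk⟩
        exact ⟨⟨by rintro rfl; exact hk hi, i, rfl, h l hl i hi k hk hlk⟩, hk⟩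
    exact fun i hi j hj => ⟨(key i hi).trans (key j hj).symm, key j hj⟩

/-- The boundary of a nontrivial set of vertices of a connected graph contains an edge. -/
theorem _root_.SimpleGraph.Connected.exists_adj_of_ne_univ (h : G.Connected) {A : Set V}
    (hne : A.Nonempty) (huniv : A ≠ Set.univ) : ∃ u ∈ A, ∃ v ∉ A, G.Adj u v := by
  obtain ⟨u, hu⟩ := hne
  obtain ⟨v, hv⟩ := (Set.ne_univ_iff_exists_notMem A).1 huniv
  obtain ⟨p⟩ := h.preconnected u v
  obtain ⟨d, -, hd1, hd2⟩ := p.exists_boundary_dart A hu hv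
  exact ⟨_, hd1, _, hd2, d.adj⟩

theorem adj_of_not_reachable_compl {u v : V} (h : ¬ Gᶜ.Reachable u v) : G.Adj u v := by
  by_contra huv
  refine h ?_
  by_cases heq : u = v
  · rw [heq]
  · exact SimpleGraph.Adj.reachable ((SimpleGraph.compl_adj _ _ _).2 ⟨heq, huv⟩)

theorem isModule_of_mem_canonicalPartition {A : Set V} (hA : A ∈ canonicalPartition G) :
    IsModule G A := by
  rcases hA with ⟨-, -, h⟩ | ⟨-, c, rfl⟩
  · exact h.prop.1
  · refine isModule_iff.2 fun i hi j hj k hk _ => adj_of_not_reachable_compl fun h => hk ?_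
    rw [SimpleGraph.ConnectedComponent.mem_supp_iff] at hj ⊢
    rw [← hj]
    exact SimpleGraph.ConnectedComponent.sound h.symm

theorem nonempty_of_mem_canonicalPartition {A : Set V} (hA : A ∈ canonicalPartition G) :
    A.Nonempty := by
  rcases hA with ⟨-, h, -⟩ | ⟨-, c, rfl⟩
  exacts [h, c.nonempty_supp]

/-- If `G` and its complement are connected, a proper module which meets a maximal proper
module is contained in it. -/
theorem IsModule.subset_of_maximal {A B : Set V} (hG : G.Connected) (hGc : Gᶜ.Connected)
    (hA : Maximal (fun B => IsModule G B ∧ B ≠ Set.univ) A) (hB : IsModule G B)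
    (hB' : B ≠ Set.univ) {w : V} (hwA : w ∈ A) (hwB : w ∈ B) : B ⊆ A := by
  have hA1 := isModule_iff.1 hA.prop.1
  have hB1 := isModule_iff.1 hB
  have hmod : IsModule G (A ∪ B) := by
    have key : ∀ i ∈ A ∪ B, ∀ k ∉ A ∪ B, G.Adj i k ↔ G.Adj w k := by
      intro i hi k hk
      simp only [Set.mem_union, not_or] at hk
      rcases hi with hi | hi
      · exact ⟨hA1 i hi w hwA k hk.1, hA1 w hwA i hi k hk.1⟩
      · exact ⟨hB1 i hi w hwB k hk.2, hB1 w hwB i hi k hk.2⟩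
    exact isModule_iff.2 fun i hi j hj k hk h => (key j hj k hk).2 ((key i hi k hk).1 h)
  by_cases huniv : A ∪ B = Set.univ
  · exfalso
    have hcov : ∀ k, k ∉ A → k ∈ B := fun k hk =>
      ((huniv ▸ Set.mem_univ k : k ∈ A ∪ B)).resolve_left hk
    -- Take `u` in `A` outside `B`. An edge and a non-edge leaving `A` end at vertices of `B`,
    -- exactly one of which is adjacent to `u`, as `A` is a module; this contradicts that `B` is
    -- one.
    obtain ⟨u, hu⟩ := (Set.ne_univ_iff_exists_notMem B).1 hB'
    have huA : u ∈ A := by_contra fun h => hu (hcov u h)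
    obtain ⟨a, ha, v, hv, hav⟩ := hG.exists_adj_of_ne_univ ⟨w, hwA⟩ hA.prop.2
    obtain ⟨a', ha', v', hv', hav'⟩ := hGc.exists_adj_of_ne_univ ⟨w, hwA⟩ hA.prop.2
    have h1 : G.Adj u v := hA1 a ha u huA v hv hav
    have h2 : G.Adj v' u := hB1 v (hcov v hv) v' (hcov v' hv') u hu h1.symm
    exact ((SimpleGraph.compl_adj _ _ _).1 hav').2 (hA1 u huA a' ha' v' hv' h2.symm)
  · exact Set.subset_union_right.trans (hA.2 ⟨hmod, huniv⟩ Set.subset_union_left)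

theorem eq_of_mem_canonicalPartition (hG : G.Connected) {A B : Set V}
    (hA : A ∈ canonicalPartition G) (hB : B ∈ canonicalPartition G) {w : V} (hwA : w ∈ A)
    (hwB : w ∈ B) : A = B := by
  rcases hA with ⟨hc, -, hA⟩ | ⟨hc, c, rfl⟩ <;> rcases hB with ⟨hc', -, hB⟩ | ⟨hc', c', rfl⟩
  · exact (IsModule.subset_of_maximal hG hc hB hA.prop.1 hA.prop.2 hwB hwA).antisymm
      (IsModule.subset_of_maximal hG hc hA hB.prop.1 hB.prop.2 hwA hwB)
  · exact absurd hc hc'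
  · exact absurd hc' hc
  · rw [SimpleGraph.ConnectedComponent.mem_supp_iff] at hwA hwB
    rw [← hwA, ← hwB]

theorem exists_mem_canonicalPartition_of_isModule [Finite V] (hGc : Gᶜ.Connected) {B : Set V}
    (hB : IsModule G B) (hB' : B ≠ Set.univ) (hne : B.Nonempty) :
    ∃ A ∈ canonicalPartition G, B ⊆ A := by
  obtain ⟨A, hBA, hA⟩ :=
    Finite.exists_le_maximal (p := fun B => IsModule G B ∧ B ≠ Set.univ) ⟨hB, hB'⟩
  exact ⟨A, Or.inl ⟨hGc, hne.mono hBA, hA⟩, hBA⟩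

theorem copartition_adj {u v : V} : (copartition G).Adj u v ↔
    G.Adj u v ∧ ¬ ∃ A ∈ canonicalPartition G, u ∈ A ∧ v ∈ A := Iff.rfl

/-- A transitive orientation of the copartition subgraph extends to one of `G`. -/
theorem IsTransitiveOrientation.exists_extension (hG : G.Connected) (hcomp : IsComparabilityGraph G)
    {O' : V → V → Prop} (hO' : IsTransitiveOrientation (copartition G) O') :
    ∃ O, IsTransitiveOrientation G O ∧ (∀ u v, O' u v → O u v) ∧
      ∀ u v, O u v → O' u v ∨ ∃ A ∈ canonicalPartition G, u ∈ A ∧ v ∈ A := by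
  obtain ⟨O₀, hO₀⟩ := hcomp.exists_isTransitiveOrientation
  refine ⟨_, IsTransitiveOrientation.substitute
    (S := fun u v => ∃ A ∈ canonicalPartition G, u ∈ A ∧ v ∈ A) ?_ ?_ ?_
    (fun u v => copartition_adj) hO₀ hO', fun u v h => Or.inl h, fun u v h => h.imp_right And.left⟩
  · rintro u v ⟨A, hA, hu, hv⟩
    exact ⟨A, hA, hv, hu⟩
  · rintro u v w ⟨A, hA, hu, hv⟩ ⟨B, hB, hv', hw⟩
    obtain rfl := eq_of_mem_canonicalPartition hG hA hB hv hv'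
    exact ⟨A, hA, hu, hw⟩
  · rintro u v w ⟨A, hA, hu, hv⟩ hw
    have hwA : w ∉ A := fun h => hw ⟨A, hA, hu, h⟩
    have := isModule_iff.1 (isModule_of_mem_canonicalPartition hA)
    exact ⟨this u hu v hv w hwA, this v hv u hu w hwA⟩

end Modules

/-! ### Top eigenvectors and modules -/

section Spectral

variable {V : Type*} [Fintype V] [DecidableEq V] {G : SimpleGraph V} [DecidableRel G.Adj]
  {O : V → V → Prop} {x : EuclideanSpace ℝ V}

omit [DecidableEq V] in
theorem sum_ite_mem_eq_ncard_mul (S : Set V) [DecidablePred (· ∈ S)] (c : ℝ) :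
    ∑ k, (if k ∈ S then c else 0) = S.ncard * c := by
  rw [← Finset.sum_filter, Finset.sum_const, nsmul_eq_mul, ← Set.ncard_coe_finset]
  simp

/-- An eigenvector of the Laplacian is constant on a module if the eigenvalue exceeds the number of
vertices which are in the module or adjacent to it. -/
theorem IsModule.eq_of_card_lt {A : Set V} (hA : IsModule G A) {a : ℝ}
    (hx : ∀ i, lapOp G x i = a * x i) (ha : ((A ∪ openNbhd G A).ncard : ℝ) < a) :
    ∀ i ∈ A, ∀ j ∈ A, x i = x j := by
  classical
  intro i₀ hi₀ j₀ hj₀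
  obtain ⟨i, hi, hmax⟩ := A.toFinset.exists_max_image (fun i => x i) ⟨i₀, by simpa using hi₀⟩
  obtain ⟨j, hj, hmin⟩ := A.toFinset.exists_min_image (fun i => x i) ⟨i₀, by simpa using hi₀⟩
  simp only [Set.mem_toFinset] at hi hj hmax hmin
  have hij : x j ≤ x i := hmax j hj
  -- Since `i` and `j` attain the maximum and minimum on `A`, a vertex of `A` contributes at most `x
  -- i - x j`. An outside neighbour is common to both and contributes exactly that; other vertices
  -- contribute nothing.
  have hterm : ∀ k, ((if G.Adj i k then x i - x k else 0) - if G.Adj j k then x j - x k else 0) ≤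
      if k ∈ A ∪ openNbhd G A then x i - x j else 0 := by
    intro k
    by_cases hk : k ∈ A
    · have h1 := hmax k hk
      have h2 := hmin k hk
      simp only [Set.mem_union, hk, true_or, if_true]
      split_ifs <;> linarith
    · have h1 : G.Adj i k ↔ G.Adj j k :=
        ⟨isModule_iff.1 hA i hi j hj k hk, isModule_iff.1 hA j hj i hi k hk⟩
      by_cases h2 : G.Adj i k
      · have h3 : k ∈ A ∪ openNbhd G A := Or.inr ⟨hk, i, hi, h2⟩
        simp only [h2, h1.1 h2, h3, if_true]
        linarith
      · simp only [h2, mt h1.2 h2, if_false, sub_zero]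
        split_ifs <;> linarith
  have hle : a * x i - a * x j ≤ (A ∪ openNbhd G A).ncard * (x i - x j) := by
    rw [← hx, ← hx, lapOp_apply, lapOp_apply, ← Finset.sum_sub_distrib]
    exact (Finset.sum_le_sum fun k _ => hterm k).trans (sum_ite_mem_eq_ncard_mul _ _).le
  have heq : x i = x j := by
    by_contra hne
    have : 0 < x i - x j := sub_pos.2 (lt_of_le_of_ne hij (Ne.symm hne))
    nlinarith
  have h1 := hmax i₀ hi₀
  have h2 := hmax j₀ hj₀
  have h3 := hmin i₀ hi₀
  have h4 := hmin j₀ hj₀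
  linarith

/-- The edges between the module and its neighbourhood `N` form a complete bipartite graph, whose
top eigenvector already has Rayleigh quotient `|A| + |N|`. An edge leaving `A ∪ N` increases the
quotient strictly. Connectedness of the complement leaves room outside `A ∪ N`, and connectedness of
`G` provides the edge. -/
theorem IsModule.card_lt_lamMax [Nonempty V] {A : Set V} (hA : IsModule G A) (hne : A.Nonempty)
    (hproper : A ≠ Set.univ) (hG : G.Connected) (hGc : Gᶜ.Connected) :
    ((A ∪ openNbhd G A).ncard : ℝ) < lamMax G := by
  classical
  have hmod := isModule_iff.1 hA
  set N := openNbhd G A with hN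
  have hAN : ∀ i ∈ A, ∀ k ∈ N, G.Adj i k := by
    rintro i hi k ⟨hk, j, hj, hjk⟩
    exact hmod j hj i hi k hk hjk
  have hdisj : Disjoint A N := Set.disjoint_left.2 fun k hk hk' => hk'.1 hk
  have huniv : A ∪ N ≠ Set.univ := by
    intro h
    obtain ⟨u, hu, v, hv, huv⟩ := hGc.exists_adj_of_ne_univ hne hproper
    refine ((SimpleGraph.compl_adj _ _ _).1 huv).2 (hAN u hu v ?_)
    exact ((h ▸ Set.mem_univ v : v ∈ A ∪ N)).resolve_left hv
  obtain ⟨u, hu, v, hv, huv⟩ := hG.exists_adj_of_ne_univ (hne.mono Set.subset_union_left) huniv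
  rw [Set.mem_union, not_or] at hv
  have huN : u ∈ N := hu.resolve_left fun h => hv.2 ⟨hv.1, u, h, huv⟩
  set a : ℝ := (A.ncard : ℝ) with ha
  set m : ℝ := (N.ncard : ℝ) with hm
  have hcard : ((A ∪ N).ncard : ℝ) = a + m := by
    rw [Set.ncard_union_eq hdisj, Nat.cast_add]
  have ha0 : 0 < a := by
    rw [ha, Nat.cast_pos, Set.ncard_pos]
    exact hne
  have hm0 : 0 < m := by
    rw [hm, Nat.cast_pos, Set.ncard_pos]
    exact ⟨u, huN⟩
  -- The weights make `w` the zero-sum vector which is constant on both sides of the complete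
  -- bipartite graph.
  set w : EuclideanSpace ℝ V :=
    WithLp.toLp 2 fun i => if i ∈ A then m else if i ∈ N then -a else 0 with hw
  have hwA : ∀ i ∈ A, w i = m := fun i hi => by simp [hw, hi]
  have hwN : ∀ i ∈ N, w i = -a := fun i hi => by simp [hw, hi, hdisj.notMem_of_mem_right hi]
  have hw0 : ∀ i, i ∉ A → i ∉ N → w i = 0 := fun i h1 h2 => by simp [hw, h1, h2]
  have hLA : ∀ i ∈ A, lapOp G w i = m * (m + a) := by
    intro i hi
    rw [lapOp_apply, hm, ← sum_ite_mem_eq_ncard_mul]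
    refine Finset.sum_congr rfl fun k _ => ?_
    by_cases hkA : k ∈ A
    · simp [hwA i hi, hwA k hkA, hdisj.notMem_of_mem_left hkA]
    · by_cases hkN : k ∈ N
      · simp [hwA i hi, hwN k hkN, hkN, hAN i hi k hkN, hm]
      · have : ¬ G.Adj i k := fun h => hkN ⟨hkA, i, hi, h⟩
        simp [hkN, this]
  have htermN : ∀ i ∈ N, ∀ k, (if G.Adj i k then w i - w k else 0) ≤
      if k ∈ A then -(a + m) else 0 := by
    intro i hi k
    by_cases hkA : k ∈ A
    · simp only [hwN i hi, hwA k hkA, hkA, (hAN k hkA i hi).symm, if_true]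
      linarith
    · simp only [hkA, if_false, hwN i hi]
      by_cases hkN : k ∈ N
      · simp [hwN k hkN]
      · rw [hw0 k hkA hkN]
        split_ifs <;> linarith
  have hLN : ∀ i ∈ N, lapOp G w i ≤ -(a * (a + m)) := by
    intro i hi
    rw [lapOp_apply, ← mul_neg]
    nth_rw 1 [ha]
    rw [← sum_ite_mem_eq_ncard_mul]
    exact Finset.sum_le_sum fun k _ => htermN i hi k
  have hLu : lapOp G w u < -(a * (a + m)) := by
    rw [lapOp_apply, ← mul_neg]
    nth_rw 1 [ha]
    rw [← sum_ite_mem_eq_ncard_mul]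
    refine Finset.sum_lt_sum (fun k _ => htermN u huN k) ⟨v, Finset.mem_univ _, ?_⟩
    simpa [huv, hv.1, hwN u huN, hw0 v hv.1 hv.2] using ha0
  have hkey : (a + m) * ∑ i, w i * w i < ∑ i, w i * lapOp G w i := by
    rw [Finset.mul_sum]
    refine Finset.sum_lt_sum (fun i _ => ?_) ⟨u, Finset.mem_univ _, ?_⟩
    · by_cases hiA : i ∈ A
      · rw [hLA i hiA, hwA i hiA]
        linarith
      · by_cases hiN : i ∈ N
        · rw [hwN i hiN]
          nlinarith [hLN i hiN]
        · simp [hw0 i hiA hiN]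
    · rw [hwN u huN]
      nlinarith [hLu]
  have hpos : 0 < ∑ i, w i * w i := by
    obtain ⟨i, hi⟩ := hne
    refine Finset.sum_pos' (fun i _ => mul_self_nonneg _) ⟨i, Finset.mem_univ _, ?_⟩
    rw [hwA i hi]
    positivity
  rw [hcard]
  exact lt_of_mul_lt_mul_right (hkey.trans_le (sum_mul_lapOp_le w)) hpos.le

/-- The components of a fiber of a top eigenvector are modules. -/
theorem IsTransitiveOrientation.isModule_image_supp (h : IsTransitiveOrientation G O)
    (hx : x ∈ cone G O) (hE : x ∈ topEigenspace G) {F : Set V} (hF : IsFiber x F)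
    (c : (G.induce F).ConnectedComponent) : IsModule G (Subtype.val '' c.supp) := by
  obtain ⟨a, ha⟩ := hF
  have hmem : ∀ i ∈ c.supp, ∀ k (hk : k ∈ F), G.Adj i k → k ∈ Subtype.val '' c.supp := by
    intro i hi k hk hik
    exact ⟨⟨k, hk⟩, c.mem_supp_of_adj_mem_supp hi hik, rfl⟩
  refine isModule_iff.2 ?_
  rintro _ ⟨i, hi, rfl⟩ _ ⟨j, hj, rfl⟩ k hk hik
  obtain ⟨p⟩ := c.reachable_of_mem_supp hi hj
  induction p with
  | nil => exact hik
  | @cons i l j hil _ ih =>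
    -- Adjacency to `k` is passed along a walk inside the component: a vertex `k` distinguishing two
    -- consecutive vertices would lie in the fiber, hence in the component.
    refine ih (c.mem_supp_of_adj_mem_supp hi hil) hj ?_
    by_contra hlk
    have heq : x i = x l := ((ha i).2 i.2).trans ((ha l).2 l.2).symm
    have hki := h.eq_of_adj_of_not_adj hx hE hil heq hik hlk
    exact hk (hmem i hi k ((ha k).1 (hki.trans ((ha i).2 i.2))) hik)

omit [Fintype V] [DecidableEq V] [DecidableRel G.Adj] in
theorem connected_induce_image_supp {F : Set V} (c : (G.induce F).ConnectedComponent) :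
    (G.induce (Subtype.val '' c.supp : Set V)).Connected := by
  refine c.connected_toSimpleGraph.map
    (⟨fun v => ⟨v.1.1, v.1, v.2, rfl⟩, fun h => h⟩ :
      ((G.induce F).induce c.supp) →g (G.induce (Subtype.val '' c.supp : Set V))) ?_
  rintro ⟨_, i, hi, rfl⟩
  exact ⟨⟨i, hi⟩, rfl⟩

/-- Adjacent vertices with equal entries in a nonzero top eigenvector are in a common proper
connected module on which this vector is constant. -/
theorem IsTransitiveOrientation.exists_isConnectedModule [Nonempty V]
    (h : IsTransitiveOrientation G O) (hx : x ∈ cone G O) (hE : x ∈ topEigenspace G) (h0 : x ≠ 0)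
    {u v : V} (huv : G.Adj u v) (heq : x u = x v) :
    ∃ B : Set V, IsConnectedModule G B ∧ B ≠ Set.univ ∧ u ∈ B ∧ v ∈ B ∧ (∀ i ∈ B, x i = x u) ∧
      ∀ i ∈ B, ∀ j ∉ B, G.Adj i j → x j ≠ x u := by
  set F : Set V := {i | x i = x u} with hF
  have hfib : IsFiber x F := ⟨x u, fun i => Iff.rfl⟩
  have huF : u ∈ F := rfl
  have hvF : v ∈ F := heq.symm
  set c := (G.induce F).connectedComponentMk ⟨u, huF⟩ with hc
  have huc : (⟨u, huF⟩ : F) ∈ c.supp := rfl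
  have hB : ∀ i ∈ Subtype.val '' c.supp, x i = x u := by
    rintro _ ⟨i, -, rfl⟩
    exact i.2
  refine ⟨Subtype.val '' c.supp,
    ⟨h.isModule_image_supp hx hE hfib c, connected_induce_image_supp c⟩, ?_, ⟨_, huc, rfl⟩,
    ⟨⟨v, hvF⟩, c.mem_supp_of_adj_mem_supp huc huv, rfl⟩, hB, ?_⟩
  · intro huniv
    refine h0 (eq_zero_of_mem_topEigenspace_of_const huv hE fun i j => ?_)
    rw [hB i (huniv ▸ Set.mem_univ i), hB j (huniv ▸ Set.mem_univ j)]
  · rintro _ ⟨i, hi, rfl⟩ j hj hij hju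
    exact hj ⟨⟨j, hju⟩, c.mem_supp_of_adj_mem_supp hi hij, rfl⟩

end Spectral

/-! ### Graphs with disconnected complement -/

section Disconnected

variable {V : Type*} [Fintype V] [DecidableEq V] {G : SimpleGraph V} [DecidableRel G.Adj]
  {x : EuclideanSpace ℝ V}

/-- The sum is the Laplacian of the complete graph. On zero-sum vectors it turns the eigenvalue `n`
of `G` into the kernel for the complement. -/
theorem lapOp_add_lapOp_compl (x : EuclideanSpace ℝ V) (i : V) :
    lapOp G x i + lapOp Gᶜ x i = Fintype.card V * x i - ∑ k, x k := by
  have h : (Fintype.card V : ℝ) * x i = ∑ _k : V, x i := by simp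
  rw [lapOp_apply, lapOp_apply, h, ← Finset.sum_sub_distrib, ← Finset.sum_add_distrib]
  refine Finset.sum_congr rfl fun k _ => ?_
  by_cases hik : i = k
  · subst hik
    simp
  · by_cases h' : G.Adj i k <;> simp [h', hik]

theorem lapOp_eq_zero_iff {H : SimpleGraph V} [DecidableRel H.Adj] :
    lapOp H x = 0 ↔ ∀ i j, H.Reachable i j → x i = x j := by
  rw [← SimpleGraph.lapMatrix_mulVec_eq_zero_iff_forall_reachable (G := H)]
  constructor
  · intro h
    ext i
    exact congrArg (fun y : EuclideanSpace ℝ V => y i) h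
  · intro h
    ext i
    exact congrFun h i

variable [Nonempty V]

omit [Fintype V] [DecidableEq V] [DecidableRel G.Adj] in
theorem exists_not_reachable_of_not_connected {H : SimpleGraph V} (h : ¬ H.Connected) :
    ∃ u v, ¬ H.Reachable u v := by
  by_contra! hall
  exact h ⟨hall⟩

omit [DecidableEq V] [DecidableRel G.Adj] in
/-- A vector with zero sum which is constant on components and separates two of them. -/
theorem exists_sum_eq_zero_of_not_reachable {H : SimpleGraph V} {u v : V}
    (h : ¬ H.Reachable u v) : ∃ x : EuclideanSpace ℝ V, ∑ i, x i = 0 ∧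
      (∀ i j, H.Reachable i j → x i = x j) ∧ x u ≠ x v := by
  classical
  set A : Set V := {i | H.Reachable u i} with hA
  -- The indicator of the component of `u`, centred and scaled by the number of vertices.
  refine ⟨WithLp.toLp 2 fun i => (if i ∈ A then (Fintype.card V : ℝ) else 0) - A.ncard, ?_, ?_, ?_⟩
  · rw [Finset.sum_sub_distrib, sum_ite_mem_eq_ncard_mul]
    simp [mul_comm]
  · intro i j hij
    have : i ∈ A ↔ j ∈ A := ⟨fun h => h.trans hij, fun h => h.trans hij.symm⟩
    simp [this]
  · simp [hA, h]

omit [Nonempty V] in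
theorem lapOp_apply_of_sum_eq_zero (hsum : ∑ i, x i = 0)
    (hx : ∀ i j, Gᶜ.Reachable i j → x i = x j) (i : V) :
    lapOp G x i = Fintype.card V * x i := by
  have h := lapOp_add_lapOp_compl (G := G) x i
  rw [lapOp_eq_zero_iff.2 hx, hsum] at h
  simpa using h

/-- The whole vertex set is a module, so a larger eigenvalue would force constant eigenvectors,
which `L` kills. -/
theorem lamMax_le_card : lamMax G ≤ Fintype.card V := by
  by_contra! hlt
  obtain ⟨x, hx, h0⟩ := exists_ne_zero_mem_topEigenspace (G := G)
  have hx' := mem_topEigenspace_iff.1 hx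
  have hmod : IsModule G Set.univ := isModule_iff.2 fun i _ j _ k hk => absurd trivial hk
  have hconst := hmod.eq_of_card_lt hx' (by
    refine lt_of_le_of_lt ?_ hlt
    rw [← Nat.card_eq_fintype_card]
    exact_mod_cast Set.ncard_le_card _)
  have hpos : 0 < lamMax G := lt_of_le_of_lt (by positivity) hlt
  refine h0 ?_
  ext i
  have h := hx' i
  rw [lapOp_apply, Finset.sum_eq_zero fun k _ => by
    rw [hconst i trivial k trivial, sub_self, ite_self]] at h
  exact (mul_eq_zero.1 h.symm).resolve_left hpos.ne'

theorem lamMax_eq_card (hGc : ¬ Gᶜ.Connected) : lamMax G = Fintype.card V := by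
  refine le_antisymm lamMax_le_card ?_
  obtain ⟨u, v, huv⟩ := exists_not_reachable_of_not_connected hGc
  obtain ⟨x, h1, h2, h3⟩ := exists_sum_eq_zero_of_not_reachable huv
  refine le_lamMax (Module.End.hasEigenvalue_of_hasEigenvector (x := x) ⟨?_, ?_⟩)
  · rw [Module.End.mem_eigenspace_iff]
    ext i
    exact lapOp_apply_of_sum_eq_zero h1 h2 i
  · rintro rfl
    simp at h3

/-- If the complement of `G` is disconnected, the top eigenspace consists of the vectors with zero
sum which are constant on the components of the complement. -/
theorem mem_topEigenspace_iff_of_not_connected (hGc : ¬ Gᶜ.Connected) :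
    x ∈ topEigenspace G ↔ ∑ i, x i = 0 ∧ ∀ i j, Gᶜ.Reachable i j → x i = x j := by
  constructor
  · intro hx
    obtain ⟨u, v, huv⟩ := exists_not_reachable_of_not_connected hGc
    have hsum := sum_eq_zero_of_mem_topEigenspace (adj_of_not_reachable_compl huv) hx
    refine ⟨hsum, lapOp_eq_zero_iff.1 ?_⟩
    ext i
    have h := lapOp_add_lapOp_compl (G := G) x i
    rw [mem_topEigenspace_iff.1 hx, lamMax_eq_card hGc, hsum] at h
    simp only [PiLp.zero_apply]
    linarith
  · rintro ⟨hsum, hx⟩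
    refine mem_topEigenspace_iff.2 fun i => ?_
    rw [lapOp_apply_of_sum_eq_zero hsum hx, lamMax_eq_card hGc]

/-- Pulling back functions on the components identifies the eigenspace with the kernel of a nonzero
functional, which weights each component by its size. -/
theorem finrank_topEigenspace_of_not_connected (hGc : ¬ Gᶜ.Connected) :
    Module.finrank ℝ (topEigenspace G) + 1 = Nat.card Gᶜ.ConnectedComponent := by
  classical
  set Φ : (Gᶜ.ConnectedComponent → ℝ) →ₗ[ℝ] EuclideanSpace ℝ V :=
    (WithLp.linearEquiv 2 ℝ (V → ℝ)).symm.toLinearMap ∘ₗ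
      LinearMap.funLeft ℝ ℝ Gᶜ.connectedComponentMk with hΦ
  have hΦ' : ∀ f i, Φ f i = f (Gᶜ.connectedComponentMk i) := fun f i => rfl
  have hinj : Function.Injective Φ := by
    intro f g hfg
    ext c
    induction c using SimpleGraph.ConnectedComponent.ind with
    | h v => rw [← hΦ' f, ← hΦ' g, hfg]
  set ψ : Module.Dual ℝ (Gᶜ.ConnectedComponent → ℝ) :=
    ∑ v : V, LinearMap.proj (Gᶜ.connectedComponentMk v) with hψ
  have hψ' : ∀ f, ψ f = ∑ v, f (Gᶜ.connectedComponentMk v) := fun f => by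
    simp [hψ]
  have hψ0 : ψ ≠ 0 := by
    intro h
    have := hψ' fun _ => 1
    simp [h, eq_comm] at this
  have hE : topEigenspace G = (LinearMap.ker ψ).map Φ := by
    ext x
    rw [mem_topEigenspace_iff_of_not_connected hGc]
    constructor
    · rintro ⟨hsum, hx⟩
      refine ⟨fun c => x c.out, ?_, ?_⟩
      · rw [SetLike.mem_coe, LinearMap.mem_ker, hψ', ← hsum]
        refine Finset.sum_congr rfl fun i _ => hx _ _ ?_
        exact SimpleGraph.ConnectedComponent.exact (Quot.out_eq _)
      · ext i
        rw [hΦ']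
        exact hx _ _ (SimpleGraph.ConnectedComponent.exact (Quot.out_eq _))
    · rintro ⟨f, hf, rfl⟩
      refine ⟨?_, fun i j hij => ?_⟩
      · rw [SetLike.mem_coe, LinearMap.mem_ker, hψ'] at hf
        exact hf
      · rw [hΦ', hΦ', SimpleGraph.ConnectedComponent.sound hij]
  rw [hE, ← (Submodule.equivMapOfInjective Φ hinj _).finrank_eq,
    Module.Dual.finrank_ker_add_one_of_ne_zero hψ0, Module.finrank_fintype_fun_eq_card,
    Nat.card_eq_fintype_card]

end Disconnected

/-! ### Top eigenvectors and the canonical partition -/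

section Partition

variable {V : Type*} [Fintype V] [DecidableEq V] [Nonempty V] {G : SimpleGraph V}
  [DecidableRel G.Adj] {O : V → V → Prop} {x : EuclideanSpace ℝ V}

/-- Top eigenvectors are constant on the blocks of the canonical partition. -/
theorem eq_of_mem_block (hG : G.Connected) (hx : x ∈ topEigenspace G) {A : Set V}
    (hA : A ∈ canonicalPartition G) : ∀ i ∈ A, ∀ j ∈ A, x i = x j := by
  rcases hA with ⟨hGc, hne, h⟩ | ⟨hGc, c, rfl⟩
  · exact h.prop.1.eq_of_card_lt (mem_topEigenspace_iff.1 hx)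
      (h.prop.1.card_lt_lamMax hne h.prop.2 hG hGc)
  · exact fun i hi j hj => ((mem_topEigenspace_iff_of_not_connected hGc).1 hx).2 _ _
      (c.reachable_of_mem_supp hi hj)

/-- Otherwise the edge would lie in a proper module, hence in a maximal one, which is a block. -/
theorem IsTransitiveOrientation.ne_of_copartition_adj (h : IsTransitiveOrientation G O)
    (hGc : Gᶜ.Connected) (hx : x ∈ cone G O) (hE : x ∈ topEigenspace G) (h0 : x ≠ 0) {u v : V}
    (huv : (copartition G).Adj u v) : x u ≠ x v := by
  intro heq
  obtain ⟨B, hB, hB', hu, hv, -⟩ := h.exists_isConnectedModule hx hE h0 huv.1 heq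
  obtain ⟨A, hA, hBA⟩ := exists_mem_canonicalPartition_of_isModule hGc hB.1 hB' ⟨u, hu⟩
  exact huv.2 ⟨A, hA, hBA hu, hBA hv⟩

theorem IsTransitiveOrientation.exists_ne_zero_mem_cone (h : IsTransitiveOrientation G O) :
    ∃ z ∈ cone G O, z ∈ topEigenspace G ∧ z ≠ 0 := by
  by_contra! hall
  obtain ⟨x, hx, h0⟩ := exists_ne_zero_mem_topEigenspace (G := G)
  rw [← h.span_cone_inter] at hx
  refine h0 ?_
  have : Submodule.span ℝ (cone G O ∩ (topEigenspace G : Set (EuclideanSpace ℝ V))) ≤ ⊥ :=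
    Submodule.span_le.2 fun z hz => hall z hz.1 hz.2
  exact this hx

/-- If `G` and its complement are connected, all top eigenvectors are multiples of one in the cone
of a transitive orientation. -/
theorem IsTransitiveOrientation.exists_eq_smul (h : IsTransitiveOrientation G O)
    (hG : G.Connected) (hGc : Gᶜ.Connected) {u v : V} (huv : G.Adj u v) {y z : EuclideanSpace ℝ V}
    (hz : z ∈ cone G O) (hzE : z ∈ topEigenspace G) (hz0 : z ≠ 0)
    (hyE : y ∈ topEigenspace G) : ∃ c : ℝ, y = c • z := by
  classical
  set D : Finset (V × V) :=
    Finset.univ.filter fun p => O p.1 p.2 ∧ (copartition G).Adj p.1 p.2 with hD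
  have hpos : ∀ i j, O i j → (copartition G).Adj i j → 0 < z j - z i := fun i j hij hadj =>
    sub_pos.2 (lt_of_le_of_ne (h.mem_cone_iff.1 hz i j hij)
      (h.ne_of_copartition_adj hGc hz hzE hz0 hadj))
  have hblock : ∀ w ∈ topEigenspace G, ∀ i j, G.Adj i j → ¬ (copartition G).Adj i j →
      w i = w j := by
    intro w hw i j hij hadj
    rw [copartition_adj, not_and, not_not] at hadj
    obtain ⟨A, hA, hi, hj⟩ := hadj hij
    exact eq_of_mem_block hG hw hA i hi j hj
  have hne : D.Nonempty := by
    rw [Finset.nonempty_iff_ne_empty]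
    intro hempty
    have hno : ∀ i j, O i j → ¬ (copartition G).Adj i j := fun i j hij hadj => by
      have : (i, j) ∈ D := by simp [hD, hij, hadj]
      simp [hempty] at this
    refine hz0 (eq_zero_of_mem_topEigenspace_of_const huv hzE (eq_of_forall_adj_eq hG ?_))
    intro i j hij
    rcases (h.adj_iff i j).1 hij with h' | h'
    · exact hblock z hzE i j hij (hno i j h')
    · exact (hblock z hzE j i hij.symm (hno j i h')).symm
  obtain ⟨⟨i₀, j₀⟩, hmem, hmin⟩ := D.exists_min_image
    (fun p => (y p.2 - y p.1) / (z p.2 - z p.1)) hne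
  simp only [hD, Finset.mem_filter, Finset.mem_univ, true_and] at hmem hmin
  -- The minimal ratio is the largest `c` for which `y - c • z` is still in the cone. This vector no
  -- longer separates the edge `i₀ j₀`, so it must be zero.
  set c := (y j₀ - y i₀) / (z j₀ - z i₀) with hc
  refine ⟨c, ?_⟩
  rw [← sub_eq_zero]
  by_contra hx0
  have hxE : y - c • z ∈ topEigenspace G := sub_mem hyE (Submodule.smul_mem _ _ hzE)
  have hxC : y - c • z ∈ cone G O := by
    refine h.mem_cone_iff.2 fun i j hij => ?_
    by_cases hadj : (copartition G).Adj i j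
    · have h1 := hmin (i, j) ⟨hij, hadj⟩
      rw [le_div_iff₀ (hpos i j hij hadj)] at h1
      simp only [PiLp.sub_apply, PiLp.smul_apply, smul_eq_mul]
      linarith
    · exact (hblock _ hxE i j (h.adj hij) hadj).le
  refine h.ne_of_copartition_adj hGc hxC hxE hx0 hmem.2 ?_
  have h1 : c * (z j₀ - z i₀) = y j₀ - y i₀ := div_mul_cancel₀ _ (hpos _ _ hmem.1 hmem.2).ne'
  simp only [PiLp.sub_apply, PiLp.smul_apply, smul_eq_mul]
  linarith

theorem finrank_topEigenspace_of_connected (hG : G.Connected) (hcomp : IsComparabilityGraph G)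
    (hGc : Gᶜ.Connected) : Module.finrank ℝ (topEigenspace G) = 1 := by
  refine le_antisymm ?_ finrank_topEigenspace_pos
  rcases subsingleton_or_nontrivial V with hV | hV
  · refine (Submodule.finrank_le _).trans ?_
    rw [finrank_euclideanSpace]
    exact Fintype.card_le_one_iff_subsingleton.2 hV
  · obtain ⟨u, v, huv⟩ : ∃ u v, G.Adj u v := by
      obtain ⟨u⟩ := ‹Nonempty V›
      obtain ⟨v, hv⟩ := hG.preconnected.exists_adj_of_nontrivial u
      exact ⟨u, v, hv⟩
    obtain ⟨O, hO⟩ := hcomp.exists_isTransitiveOrientation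
    obtain ⟨z, hz, hzE, hz0⟩ := hO.exists_ne_zero_mem_cone
    rw [← finrank_span_singleton (K := ℝ) hz0]
    refine Submodule.finrank_mono fun y hy => ?_
    obtain ⟨c, rfl⟩ := hO.exists_eq_smul hG hGc huv hz hzE hz0 hy
    exact Submodule.smul_mem _ _ (Submodule.mem_span_singleton_self z)

/-- If the top eigenspace is a line, every cone of a transitive orientation meets it in a ray. -/
theorem IsTransitiveOrientation.mem_cone_or_mem_cone_reverse (h : IsTransitiveOrientation G O)
    (hdim : Module.finrank ℝ (topEigenspace G) = 1) (hx : x ∈ topEigenspace G) :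
    x ∈ cone G O ∨ x ∈ cone G (fun u v => O v u) := by
  obtain ⟨z, hz, hzE, hz0⟩ := h.exists_ne_zero_mem_cone
  obtain ⟨c, hc⟩ := (finrank_eq_one_iff_of_nonzero' (⟨z, hzE⟩ : topEigenspace G)
    (by simpa using hz0)).1 hdim ⟨x, hx⟩
  obtain rfl : c • z = x := congrArg Subtype.val hc
  rcases le_total 0 c with h0 | h0
  · refine Or.inl (h.mem_cone_iff.2 fun i j hij => ?_)
    simpa using mul_le_mul_of_nonneg_left (h.mem_cone_iff.1 hz i j hij) h0
  · refine Or.inr (h.reverse.mem_cone_iff.2 fun i j hij => ?_)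
    simpa using mul_le_mul_of_nonpos_left (h.mem_cone_iff.1 hz j i hij) h0

/-- Every edge of the copartition subgraph is separated by some top eigenvector. -/
theorem exists_ne_of_copartition_adj (hcomp : IsComparabilityGraph G) {u v : V}
    (huv : (copartition G).Adj u v) : ∃ x ∈ topEigenspace G, x u ≠ x v := by
  by_cases hGc : Gᶜ.Connected
  · obtain ⟨O, hO⟩ := hcomp.exists_isTransitiveOrientation
    obtain ⟨z, hz, hzE, hz0⟩ := hO.exists_ne_zero_mem_cone
    exact ⟨z, hzE, hO.ne_of_copartition_adj hGc hz hzE hz0 huv⟩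
  · have hr : ¬ Gᶜ.Reachable u v := fun h => huv.2
      ⟨_, Or.inr ⟨hGc, Gᶜ.connectedComponentMk u, rfl⟩, rfl,
        (SimpleGraph.ConnectedComponent.sound h).symm⟩
    obtain ⟨x, h1, h2, h3⟩ := exists_sum_eq_zero_of_not_reachable hr
    exact ⟨x, (mem_topEigenspace_iff_of_not_connected hGc).2 ⟨h1, h2⟩, h3⟩

/-- For a directed path `u, v, w`, adjacency of `u` and `w` has two sources. With connected
complement, `x` lies in the cone of a transitive orientation of `G`. Otherwise, different values put
`u` and `w` in different components of the complement. Constancy on blocks keeps `u` and `w` in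
different blocks. -/
theorem isTransitiveOrientation_inducedOrientation (hG : G.Connected)
    (hcomp : IsComparabilityGraph G) (hx : x ∈ topEigenspace G)
    (hsep : ∀ u v, (copartition G).Adj u v → x u ≠ x v) :
    IsTransitiveOrientation (copartition G) (inducedOrientation (copartition G) x) := by
  refine isTransitiveOrientation_iff.2 ⟨fun u v => ⟨fun h => ?_, ?_⟩, ?_⟩
  · rcases lt_or_gt_of_ne (hsep u v h) with h' | h'
    exacts [Or.inl ⟨h, h'⟩, Or.inr ⟨h.symm, h'⟩]
  · rintro (h | h)
    exacts [h.1, h.1.symm]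
  · rintro u v w ⟨h1, h1'⟩ ⟨h2, h2'⟩
    refine ⟨copartition_adj.2 ⟨?_, ?_⟩, h1'.trans h2'⟩
    · by_cases hGc : Gᶜ.Connected
      · obtain ⟨O, hO, hxO⟩ : ∃ O, IsTransitiveOrientation G O ∧ x ∈ cone G O := by
          obtain ⟨O, hO⟩ := hcomp.exists_isTransitiveOrientation
          rcases hO.mem_cone_or_mem_cone_reverse
            (finrank_topEigenspace_of_connected hG hcomp hGc) hx with h | h
          exacts [⟨_, hO, h⟩, ⟨_, hO.reverse, h⟩]
        have key : ∀ i j, G.Adj i j → x i < x j → O i j := fun i j hij hlt =>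
          ((hO.adj_iff i j).1 hij).resolve_right fun h =>
            (hO.mem_cone_iff.1 hxO j i h).not_gt hlt
        exact hO.adj (hO.trans (key u v h1.1 h1') (key v w h2.1 h2'))
      · refine adj_of_not_reachable_compl fun h => ?_
        exact (h1'.trans h2').ne (((mem_topEigenspace_iff_of_not_connected hGc).1 hx).2 _ _ h)
    · rintro ⟨A, hA, hu, hw⟩
      exact (h1'.trans h2').ne (eq_of_mem_block hG hx hA u hu w hw)

/-- A top eigenvector which separates the edges of the copartition subgraph is contained in the
cone of a transitive orientation of `G`. -/
theorem exists_mem_cone_of_forall_ne (hG : G.Connected)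
    (hcomp : IsComparabilityGraph G) (hx : x ∈ topEigenspace G)
    (hsep : ∀ u v, (copartition G).Adj u v → x u ≠ x v) :
    ∃ O, IsTransitiveOrientation G O ∧ x ∈ cone G O := by
  obtain ⟨O, hO, -, h2⟩ :=
    (isTransitiveOrientation_inducedOrientation hG hcomp hx hsep).exists_extension hG hcomp
  refine ⟨O, hO, hO.mem_cone_iff.2 fun i j hij => ?_⟩
  rcases h2 i j hij with h | ⟨A, hA, hi, hj⟩
  · exact h.2.le
  · exact (eq_of_mem_block hG hx hA i hi j hj).le

/-- Every transitive orientation of the copartition subgraph is induced by a top eigenvector. -/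
theorem IsTransitiveOrientation.exists_mem_topEigenspace (hG : G.Connected)
    (hcomp : IsComparabilityGraph G) (hO : IsTransitiveOrientation (copartition G) O) :
    ∃ x ∈ topEigenspace G, ∀ u v, O u v → x u < x v := by
  classical
  obtain ⟨O₁, hO₁, h1, -⟩ := hO.exists_extension hG hcomp
  have hsep : ∀ p : V × V, ∃ z, (z ∈ cone G O₁ ∧ z ∈ topEigenspace G) ∧
      (O p.1 p.2 → z p.1 < z p.2) := by
    intro p
    by_cases hp : O p.1 p.2
    -- If no cone vector of the eigenspace were strict on this arc, their span, the whole
    -- eigenspace, would lie in a hyperplane `x u = x v`. Summing one strict vector per arc then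
    -- makes all arcs strict at once.
    · by_contra! hall
      obtain ⟨x, hx, hne⟩ := exists_ne_of_copartition_adj hcomp (hO.adj hp)
      have hle : topEigenspace G ≤ LinearMap.ker
          (EuclideanSpace.proj p.1 - EuclideanSpace.proj p.2 :
            EuclideanSpace ℝ V →L[ℝ] ℝ).toLinearMap := by
        rw [← hO₁.span_cone_inter]
        refine Submodule.span_le.2 fun z hz => ?_
        have h2 := hO₁.mem_cone_iff.1 hz.1 _ _ (h1 _ _ hp)
        simpa [sub_eq_zero] using le_antisymm h2 (hall z hz).2
      exact hne (by simpa [sub_eq_zero] using hle hx)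
    · obtain ⟨z, hz, hzE, -⟩ := hO₁.exists_ne_zero_mem_cone
      exact ⟨z, ⟨hz, hzE⟩, fun h => absurd h hp⟩
  choose z hz hz' using hsep
  refine ⟨∑ p, z p, Submodule.sum_mem _ fun p _ => (hz p).2, fun u v huv => ?_⟩
  simp only [WithLp.ofLp_sum, Finset.sum_apply]
  exact Finset.sum_lt_sum (fun p _ => hO₁.mem_cone_iff.1 (hz p).1 u v (h1 u v huv))
    ⟨(u, v), Finset.mem_univ _, hz' (u, v) huv⟩

end Partition

/-! ### Generic unit vectors of a subspace -/

section Measure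

variable {V : Type*} [Fintype V] {W : Submodule ℝ (EuclideanSpace ℝ V)}

theorem uniformUnit_ne_zero_iff {s : Set (Metric.sphere (0 : W) 1)} :
    uniformUnit W s ≠ 0 ↔ (volume : Measure W).toSphere s ≠ 0 := by
  rw [uniformUnit, Measure.smul_apply, smul_eq_mul, mul_ne_zero_iff, ENNReal.inv_ne_zero]
  exact and_iff_right (measure_ne_top _ _)

/-- Surface measure is computed from the volume of the cone over a set; the cone over the unit
vectors of `U` stays in `U`, which is a null set. -/
theorem ae_uniformUnit_notMem {U : Submodule ℝ W} (hU : U ≠ ⊤) :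
    ∀ᵐ x : Metric.sphere (0 : W) 1 ∂(uniformUnit W), (x : W) ∉ U := by
  rw [ae_iff]
  by_contra h
  rw [← ne_eq, uniformUnit_ne_zero_iff] at h
  refine h ?_
  simp only [not_not]
  have hclosed : IsClosed {x : Metric.sphere (0 : W) 1 | (x : W) ∈ U} :=
    U.closed_of_finiteDimensional.preimage continuous_subtype_val
  rw [Measure.toSphere_apply' _ hclosed.measurableSet]
  refine mul_eq_zero_of_right _ (measure_mono_null ?_ (Measure.addHaar_submodule volume U hU))
  rintro _ ⟨r, -, _, ⟨x, hx, rfl⟩, rfl⟩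
  exact U.smul_mem r hx

theorem uniformUnit_pos_of_isOpen {s : Set (Metric.sphere (0 : W) 1)} (hs : IsOpen s)
    (hne : s.Nonempty) : 0 < uniformUnit W s :=
  pos_iff_ne_zero.2 (uniformUnit_ne_zero_iff.2 (hs.measure_ne_zero _ hne))

/-- The vectors of a subspace whose entries at `u` and `v` agree. -/
def eqSubmodule (W : Submodule ℝ (EuclideanSpace ℝ V)) (u v : V) : Submodule ℝ W where
  carrier := {x | x.1 u = x.1 v}
  add_mem' {x y} (hx : x.1 u = x.1 v) (hy : y.1 u = y.1 v) := by
    simp [hx, hy]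
  zero_mem' := rfl
  smul_mem' c x (hx : x.1 u = x.1 v) := by
    simp [hx]

omit [Fintype V] in
theorem eqSubmodule_ne_top {u v : V} (h : ∃ x ∈ W, x u ≠ x v) : eqSubmodule W u v ≠ ⊤ := by
  obtain ⟨x, hx, hne⟩ := h
  intro htop
  exact hne ((htop ▸ Submodule.mem_top : (⟨x, hx⟩ : W) ∈ eqSubmodule W u v))

end Measure

/-! ### Covering by cones, generic behaviour, and counting transitive orientations -/

section Main

variable {V : Type*} [Fintype V] [DecidableEq V] [Nonempty V] {G : SimpleGraph V}
  [DecidableRel G.Adj] {O : V → V → Prop} {x : EuclideanSpace ℝ V}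

/-- Almost every unit top eigenvector separates the edges of the copartition subgraph. -/
theorem ae_forall_copartition_adj_ne (hcomp : IsComparabilityGraph G) :
    ∀ᵐ x ∂(uniformUnit (topEigenspace G)),
      ∀ u v, (copartition G).Adj u v → x.1.1 u ≠ x.1.1 v := by
  refine ae_all_iff.2 fun u => ae_all_iff.2 fun v => ?_
  by_cases huv : (copartition G).Adj u v
  · filter_upwards [ae_uniformUnit_notMem
      (eqSubmodule_ne_top (exists_ne_of_copartition_adj hcomp huv))] with x hx _
    exact hx
  · exact Filter.Eventually.of_forall fun _ h => absurd h huv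

/-- Almost every vector of the eigenspace lies in such a cone, and a finite union of closed cones
which is dense is everything. -/
theorem exists_mem_cone (hG : G.Connected) (hcomp : IsComparabilityGraph G)
    (hx : x ∈ topEigenspace G) : ∃ O, IsTransitiveOrientation G O ∧ x ∈ cone G O := by
  set S : Set (topEigenspace G) :=
    ⋃ O ∈ {O | IsTransitiveOrientation G O}, {y | y.1 ∈ cone G O} with hS
  have hSc : IsClosed S := Set.Finite.isClosed_biUnion (Set.toFinite _) fun O _ =>
    isClosed_closure.preimage continuous_subtype_val
  have hdense : Dense S := by
    have hae : ∀ᵐ y : topEigenspace G, ∀ u v, (copartition G).Adj u v → y.1 u ≠ y.1 v := by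
      refine ae_all_iff.2 fun u => ae_all_iff.2 fun v => ?_
      by_cases huv : (copartition G).Adj u v
      · have := measure_eq_zero_iff_ae_notMem.1 (Measure.addHaar_submodule volume _
          (eqSubmodule_ne_top (exists_ne_of_copartition_adj hcomp huv)))
        filter_upwards [this] with y hy _
        exact hy
      · exact Filter.Eventually.of_forall fun _ h => absurd h huv
    refine (Measure.dense_of_ae hae).mono fun y hy => ?_
    obtain ⟨O, hO, hy'⟩ := exists_mem_cone_of_forall_ne hG hcomp y.2 hy
    exact Set.mem_biUnion hO hy'
  have hmem : (⟨x, hx⟩ : topEigenspace G) ∈ S := by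
    rw [← hSc.closure_eq, hdense.closure_eq]
    trivial
  simpa [hS] using hmem

omit [DecidableEq V] [Nonempty V] [DecidableRel G.Adj] in
/-- Reversing a transitive orientation inside a connected module on which a vector from its cone
is constant, but different from its values at adjacent vertices, yields another one. -/
theorem IsTransitiveOrientation.reverse_module (hO : IsTransitiveOrientation G O)
    (hx : x ∈ cone G O) {B : Set V} (hB : IsModule G B) {a : ℝ} (hconst : ∀ i ∈ B, x i = a)
    (hne : ∀ i ∈ B, ∀ j ∉ B, G.Adj i j → x j ≠ a) :
    IsTransitiveOrientation G
      (fun u v => (O u v ∧ ¬ (u ∈ B ∧ v ∈ B)) ∨ ((u ∈ B ∧ v ∈ B) ∧ O v u)) := by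
  have hmod := isModule_iff.1 hB
  let H : SimpleGraph V :=
    { Adj := fun u v => G.Adj u v ∧ ¬ (u ∈ B ∧ v ∈ B)
      symm := ⟨fun u v h => ⟨h.1.symm, fun h' => h.2 h'.symm⟩⟩
      loopless := ⟨fun u h => h.1.ne rfl⟩ }
  have hH : IsTransitiveOrientation H (fun u v => O u v ∧ ¬ (u ∈ B ∧ v ∈ B)) := by
    refine isTransitiveOrientation_iff.2 ⟨fun u v => ?_, ?_⟩
    · change G.Adj u v ∧ ¬ (u ∈ B ∧ v ∈ B) ↔ _
      rw [hO.adj_iff]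
      tauto
    · rintro u v w ⟨h1, h1'⟩ ⟨h2, h2'⟩
      refine ⟨hO.trans h1 h2, fun ⟨hu, hw⟩ => ?_⟩
      have hv : v ∉ B := fun hv => h1' ⟨hu, hv⟩
      -- A directed path that leaves `B` through `v` and returns squeezes `x v` between two copies
      -- of `a`.
      refine hne u hu v hv (hO.adj h1) (le_antisymm ?_ ?_)
      · rw [← hconst w hw]
        exact hO.mem_cone_iff.1 hx v w h2
      · rw [← hconst u hu]
        exact hO.mem_cone_iff.1 hx u v h1
  refine IsTransitiveOrientation.substitute (S := fun u v => u ∈ B ∧ v ∈ B)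
    (fun u v h => h.symm) (fun u v w h h' => ⟨h.1, h'.2⟩) ?_ (fun u v => Iff.rfl) hO.reverse hH
  rintro u v w ⟨hu, hv⟩ hw
  have hwB : w ∉ B := fun h => hw ⟨hu, h⟩
  exact ⟨hmod u hu v hv w hwB, hmod v hv u hu w hwB⟩

/-- If the top eigenspace is covered by the cones of a transitive orientation and of its reversal,
it is a line. -/
theorem IsTransitiveOrientation.finrank_eq_one_of_forall_mem (hG : G.Connected)
    {u v : V} (huv : G.Adj u v) (hO : IsTransitiveOrientation G O)
    (hcover : ∀ y ∈ topEigenspace G, y ∈ cone G O ∨ y ∈ cone G fun u v => O v u) :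
    Module.finrank ℝ (topEigenspace G) = 1 := by
  refine le_antisymm ?_ finrank_topEigenspace_pos
  by_contra! hlt
  -- In dimension at least two the punctured eigenspace is connected, so the two closed cones
  -- covering it share a nonzero vector. That vector is constant, hence zero.
  have hpre := (isConnected_compl_singleton_of_one_lt_rank
    (E := topEigenspace G) (by exact_mod_cast Module.lt_rank_of_lt_finrank hlt) 0).isPreconnected
  obtain ⟨z, hz, hzE, hz0⟩ := hO.exists_ne_zero_mem_cone
  obtain ⟨y, hy0, hy, hy'⟩ := isPreconnected_closed_iff.1 hpre
    {y | y.1 ∈ cone G O} {y | y.1 ∈ cone G fun u v => O v u}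
    (isClosed_closure.preimage continuous_subtype_val)
    (isClosed_closure.preimage continuous_subtype_val) (fun y _ => hcover y.1 y.2)
    ⟨⟨z, hzE⟩, by simpa using hz0, hz⟩
    ⟨⟨-z, neg_mem hzE⟩, by simpa using hz0, hO.mem_cone_reverse_iff.2 (by simpa using hz)⟩
  refine hy0 (Subtype.ext (eq_zero_of_mem_topEigenspace_of_const huv y.2 ?_))
  exact hO.eq_of_mem_cone_of_neg_mem_cone hG hy (hO.mem_cone_reverse_iff.1 hy')

/-- Two orientations means one and its reversal. An edge inside a fiber would give a third by
reversal inside a module. Conversely, if all edges are separated, `x` lies in only one cone, and on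
a line every orientation has `x` in its own cone or in that of its reversal. -/
theorem ncard_isTransitiveOrientation_eq_two_iff (hG : G.Connected)
    (hcomp : IsComparabilityGraph G) {u v : V} (huv : G.Adj u v) (hx : x ∈ topEigenspace G)
    (h0 : x ≠ 0) :
    {O | IsTransitiveOrientation G O}.ncard = 2 ↔
      (Module.finrank ℝ (topEigenspace G) = 1 ∧
        ∀ F, IsFiber x F → ∀ u ∈ F, ∀ v ∈ F, ¬ G.Adj u v) := by
  constructor
  · intro hcard
    obtain ⟨O, hO, hxO⟩ := exists_mem_cone hG hcomp hx
    have honly : ∀ O', IsTransitiveOrientation G O' → O' = O ∨ O' = fun u v => O v u := by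
      obtain ⟨O₁, O₂, -, heq⟩ := Set.ncard_eq_two.1 hcard
      have hmem : ∀ O', IsTransitiveOrientation G O' → O' = O₁ ∨ O' = O₂ := fun O' h => by
        have : O' ∈ {O | IsTransitiveOrientation G O} := h
        rwa [heq] at this
      have hne := hO.reverse_ne huv
      intro O' hO'
      rcases hmem O hO with h1 | h1 <;> rcases hmem _ hO.reverse with h2 | h2
      · exact absurd (h1.trans h2.symm) hne
      · exact (hmem O' hO').imp (fun h => h.trans h1.symm) fun h => h.trans h2.symm
      · exact (hmem O' hO').symm.imp (fun h => h.trans h1.symm) fun h => h.trans h2.symm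
      · exact absurd (h1.trans h2.symm) hne
    refine ⟨hO.finrank_eq_one_of_forall_mem hG huv fun y hy => ?_, ?_⟩
    · obtain ⟨O', hO', hy'⟩ := exists_mem_cone hG hcomp hy
      rcases honly O' hO' with rfl | rfl
      exacts [Or.inl hy', Or.inr hy']
    · rintro F ⟨a, ha⟩ i hi j hj hij
      obtain ⟨B, hB, hB', hiB, hjB, hconst, hne⟩ := hO.exists_isConnectedModule hxO hx h0 hij
        (((ha i).2 hi).trans ((ha j).2 hj).symm)
      have hT := hO.reverse_module hxO hB.1 hconst hne
      -- It differs from `O` on the edge `i j` inside `B`, and from the reversal of `O` on an edge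
      -- leaving `B`.
      rcases honly _ hT with heq | heq
      · have key : ∀ i j, i ∈ B → j ∈ B → ¬ O i j := fun i j hi hj hij => by
          have h := congrFun (congrFun heq i) j
          simp only [hi, hj, hij, and_self, not_true, and_false, true_and, false_or, eq_iff_iff,
            iff_true] at h
          exact hO.asymm hij h
        rcases (hO.adj_iff i j).1 hij with h | h
        exacts [key i j hiB hjB h, key j i hjB hiB h]
      · obtain ⟨k, hk, l, hl, hkl⟩ := hG.exists_adj_of_ne_univ ⟨i, hiB⟩ hB'
        have h := congrFun (congrFun heq k) l
        simp only [hk, hl, and_false, not_false_iff, and_true, false_and, or_false,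
          eq_iff_iff] at h
        rcases (hO.adj_iff k l).1 hkl with h' | h'
        exacts [hO.asymm h' (h.1 h'), hO.asymm h' (h.2 h')]
  · rintro ⟨hdim, hind⟩
    have hne : ∀ i j, G.Adj i j → x i ≠ x j := fun i j hij heq =>
      hind {k | x k = x i} ⟨x i, fun k => Iff.rfl⟩ i rfl j heq.symm hij
    have hind' : ∀ O, IsTransitiveOrientation G O → x ∈ cone G O → O = inducedOrientation G x :=
      fun O hO hxO => (hO.inducedOrientation_eq fun i j hij =>
        lt_of_le_of_ne (hO.mem_cone_iff.1 hxO i j hij) (hne i j (hO.adj hij))).symm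
    obtain ⟨O, hO, hxO⟩ := exists_mem_cone hG hcomp hx
    refine Set.ncard_eq_two.2 ⟨O, fun u v => O v u, hO.reverse_ne huv, ?_⟩
    ext O'
    simp only [Set.mem_ofPred_eq, Set.mem_insert_iff, Set.mem_singleton_iff]
    constructor
    · intro hO'
      rw [hind' O hO hxO]
      rcases hO'.mem_cone_or_mem_cone_reverse hdim hx with h | h
      · exact Or.inl (hind' _ hO' h)
      · right
        rw [← hind' _ hO'.reverse h]
    · rintro (rfl | rfl)
      exacts [hO, hO.reverse]

/-- The fibers of a top eigenvector decompose into connected modules. -/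
theorem exists_isDisjointUnion_of_isFiber (hG : G.Connected) (hcomp : IsComparabilityGraph G)
    (hx : x ∈ topEigenspace G) {F : Set V} (hF : IsFiber x F) :
    ∃ (k : ℕ) (B : Fin k → Set V), IsDisjointUnion G F B ∧
      ∀ i, IsConnectedModule G (B i) ∧ IsComparabilityGraph (G.induce (B i)) := by
  obtain ⟨O, hO, hxO⟩ := exists_mem_cone hG hcomp hx
  obtain ⟨k, ⟨e⟩⟩ := Finite.exists_equiv_fin (G.induce F).ConnectedComponent
  refine ⟨k, fun i => Subtype.val '' (e.symm i).supp, ⟨?_, fun i j hij => ⟨?_, ?_⟩⟩, fun i =>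
    ⟨⟨hO.isModule_image_supp hxO hx hF _, connected_induce_image_supp _⟩, hcomp.induce _⟩⟩
  · ext v
    simp only [Set.mem_iUnion]
    constructor
    · intro hv
      exact ⟨e ((G.induce F).connectedComponentMk ⟨v, hv⟩), ⟨v, hv⟩, by simp, rfl⟩
    · rintro ⟨i, v, -, rfl⟩
      exact v.2
  · refine Set.disjoint_left.2 ?_
    rintro _ ⟨v, hv, rfl⟩ ⟨w, hw, hwv⟩
    obtain rfl := Subtype.ext hwv
    rw [SimpleGraph.ConnectedComponent.mem_supp_iff] at hv hw
    exact hij (e.symm.injective (hv.symm.trans hw))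
  · rintro _ ⟨v, hv, rfl⟩ _ ⟨w, hw, rfl⟩ hvw
    have hw' := (e.symm i).mem_supp_of_adj_mem_supp hv (show (G.induce F).Adj v w from hvw)
    rw [SimpleGraph.ConnectedComponent.mem_supp_iff] at hw hw'
    exact hij (e.symm.injective (hw'.symm.trans hw))

/-- Every transitive orientation of the copartition subgraph is induced with positive probability. -/
theorem IsTransitiveOrientation.uniformUnit_pos (hG : G.Connected)
    (hcomp : IsComparabilityGraph G) (hO : IsTransitiveOrientation (copartition G) O) :
    0 < uniformUnit (topEigenspace G) {x | inducedOrientation (copartition G) x.1.1 = O} := by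
  set s : Set (Metric.sphere (0 : topEigenspace G) 1) :=
    {x | x.1.1 ∈ region (copartition G) O} with hs
  have hopen : IsOpen s := hO.isOpen_region.preimage
    (continuous_subtype_val.comp continuous_subtype_val)
  refine (uniformUnit_pos_of_isOpen hopen ?_).trans_le (measure_mono fun x hx => hx.2)
  obtain ⟨z, hzE, hz0, hz⟩ : ∃ z ∈ topEigenspace G, z ≠ 0 ∧ ∀ u v, O u v → z u < z v := by
    obtain ⟨z, hzE, hz⟩ := hO.exists_mem_topEigenspace hG hcomp
    -- The zero vector can occur only when `O` has no arcs; then any nonzero vector serves.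
    by_cases hz0 : z = 0
    · obtain ⟨y, hyE, hy0⟩ := exists_ne_zero_mem_topEigenspace (G := G)
      refine ⟨y, hyE, hy0, fun u v huv => ?_⟩
      have := hz u v huv
      simp [hz0] at this
    · exact ⟨z, hzE, hz0, hz⟩
  have hnorm : 0 < ‖z‖ := norm_pos_iff.2 hz0
  refine ⟨⟨⟨‖z‖⁻¹ • z, Submodule.smul_mem _ _ hzE⟩, ?_⟩, hO.mem_region_iff.2 fun u v huv => ?_⟩
  · rw [mem_sphere_zero_iff_norm, Submodule.coe_norm, norm_smul, norm_inv, norm_norm,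
      inv_mul_cancel₀ hnorm.ne']
  · simpa using mul_lt_mul_of_pos_left (hz u v huv) (inv_pos.2 hnorm)

/-- The uniform measure is nonzero, so the almost sure separation of edges is realized by an actual
vector. -/
theorem isComparabilityGraph_copartition (hG : G.Connected) (hcomp : IsComparabilityGraph G) :
    IsComparabilityGraph (copartition G) := by
  obtain ⟨z, hzE, hz0⟩ := exists_ne_zero_mem_topEigenspace (G := G)
  have : Nontrivial (topEigenspace G) := ⟨⟨z, hzE⟩, 0, by simpa using hz0⟩
  have hne : (Set.univ : Set (Metric.sphere (0 : topEigenspace G) 1)).Nonempty := by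
    obtain ⟨y, hy⟩ := NormedSpace.sphere_nonempty (E := topEigenspace G) (x := 0) (r := 1) |>.2
      zero_le_one
    exact ⟨⟨y, hy⟩, trivial⟩
  have : NeZero (uniformUnit (topEigenspace G)) :=
    ⟨fun h => (uniformUnit_pos_of_isOpen isOpen_univ hne).ne' (by simp [h])⟩
  obtain ⟨x, hx⟩ := (ae_forall_copartition_adj_ne hcomp).exists
  exact (isTransitiveOrientation_inducedOrientation hG hcomp x.1.2 hx).isComparabilityGraph

end Main

end TopLap

/-! ### Assembly of the theorem -/

open TopLap MeasureTheory in
theorem theorem3p1 {V : Type*} [Fintype V] [DecidableEq V] (G : SimpleGraph V)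
    [DecidableRel G.Adj] (hconn : G.Connected) (hcomp : IsComparabilityGraph G) :
    -- i
    (∀ O, IsTransitiveOrientation G O →
      Module.finrank ℝ (Submodule.span ℝ (cone G O ∩ (topEigenspace G : Set (EuclideanSpace ℝ V))))
        = Module.finrank ℝ (topEigenspace G)) ∧
    -- ii
    ((topEigenspace G : Set (EuclideanSpace ℝ V)) ⊆
      ⋃ O ∈ {O | IsTransitiveOrientation G O}, cone G O) ∧
    -- iii.1
    (∀ᵐ x ∂(uniformUnit (topEigenspace G)),
      ∀ A ∈ canonicalPartition G, ∃ F, IsFiber x.1.1 F ∧ A ⊆ F) ∧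
    -- iii.2
    (∀ᵐ x ∂(uniformUnit (topEigenspace G)),
      ∀ A ∈ canonicalPartition G, ∀ A' ∈ canonicalPartition G, CompletelyAdjacent G A A' →
        ∃ F F', IsFiber x.1.1 F ∧ IsFiber x.1.1 F' ∧ A ⊆ F ∧ A' ⊆ F' ∧ F ≠ F') ∧
    -- iii.3
    (∀ᵐ x ∂(uniformUnit (topEigenspace G)),
      IsTransitiveOrientation (copartition G) (inducedOrientation (copartition G) x.1.1)) ∧
    IsComparabilityGraph (copartition G) ∧
    -- iii.4
    (∀ O, IsTransitiveOrientation (copartition G) O →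
      0 < uniformUnit (topEigenspace G) {x | inducedOrientation (copartition G) x.1.1 = O}) ∧
    -- iii.5
    (∀ᵐ x ∂(uniformUnit (topEigenspace G)),
      ∀ F, IsFiber x.1.1 F → ∃ (k : ℕ) (B : Fin k → Set V), IsDisjointUnion G F B ∧
        ∀ i, IsConnectedModule G (B i) ∧ IsComparabilityGraph (G.induce (B i))) ∧
    -- iii.6
    (2 ≤ Fintype.card V → ∀ᵐ x ∂(uniformUnit (topEigenspace G)),
      ({O | IsTransitiveOrientation G O}.ncard = 2 ↔
        (Module.finrank ℝ (topEigenspace G) = 1 ∧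
          ∀ F, IsFiber x.1.1 F → ∀ u ∈ F, ∀ v ∈ F, ¬ G.Adj u v))) ∧
    -- iv
    (Gᶜ.Connected → Module.finrank ℝ (topEigenspace G) = 1) ∧
    (¬ Gᶜ.Connected →
      (Module.finrank ℝ (topEigenspace G) : ℤ) = (Nat.card Gᶜ.ConnectedComponent : ℤ) - 1) := by
  have : Nonempty V := hconn.nonempty
  have hne : ∀ x : Metric.sphere (0 : topEigenspace G) 1, x.1.1 ≠ 0 := fun x h =>
    ne_zero_of_mem_unit_sphere x (Subtype.ext h)
  have hfiber : ∀ x : Metric.sphere (0 : topEigenspace G) 1, ∀ A ∈ canonicalPartition G,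
      ∀ u ∈ A, A ⊆ {k | x.1.1 k = x.1.1 u} := fun x A hA u hu k hk =>
    eq_of_mem_block hconn x.1.2 hA k hk u hu
  -- The claims about blocks in fibers, the decomposition of fibers, and exactly two orientations
  -- hold for every unit top eigenvector. Among the almost sure claims, only different fibers and
  -- the induced orientation need genericity.
  refine ⟨fun O hO => by rw [hO.span_cone_inter], fun x hx => ?_,
    Filter.Eventually.of_forall fun x A hA => ?_, ?_, ?_,
    isComparabilityGraph_copartition hconn hcomp, fun O hO => hO.uniformUnit_pos hconn hcomp,
    Filter.Eventually.of_forall fun x F hF => ?_,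
    fun hn => Filter.Eventually.of_forall fun x => ?_,
    finrank_topEigenspace_of_connected hconn hcomp, fun hGc => ?_⟩
  · obtain ⟨O, hO, hxO⟩ := exists_mem_cone hconn hcomp hx
    exact Set.mem_biUnion hO hxO
  · obtain ⟨u, hu⟩ := nonempty_of_mem_canonicalPartition hA
    exact ⟨_, ⟨_, fun k => Iff.rfl⟩, hfiber x A hA u hu⟩
  · filter_upwards [ae_forall_copartition_adj_ne hcomp] with x hx A hA A' hA' hAA'
    obtain ⟨u, hu⟩ := nonempty_of_mem_canonicalPartition hA
    obtain ⟨v, hv⟩ := nonempty_of_mem_canonicalPartition hA'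
    have huv : (copartition G).Adj u v := by
      refine copartition_adj.2 ⟨hAA'.2 u hu v hv, ?_⟩
      rintro ⟨B, hB, huB, hvB⟩
      have hBA := eq_of_mem_canonicalPartition hconn hB hA huB hu
      exact Set.notMem_empty v (hAA'.1 ▸ ⟨hBA ▸ hvB, hv⟩)
    refine ⟨_, _, ⟨_, fun k => Iff.rfl⟩, ⟨_, fun k => Iff.rfl⟩, hfiber x A hA u hu,
      hfiber x A' hA' v hv, fun heq => hx u v huv ?_⟩
    have : u ∈ {k | x.1.1 k = x.1.1 v} := heq ▸ (rfl : x.1.1 u = x.1.1 u)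
    exact this
  · filter_upwards [ae_forall_copartition_adj_ne hcomp] with x hx
    exact isTransitiveOrientation_inducedOrientation hconn hcomp x.1.2 hx
  · exact exists_isDisjointUnion_of_isFiber hconn hcomp x.1.2 hF
  · have : Nontrivial V := Fintype.one_lt_card_iff_nontrivial.1 hn
    obtain ⟨u⟩ := ‹Nonempty V›
    obtain ⟨v, huv⟩ := hconn.preconnected.exists_adj_of_nontrivial u
    exact ncard_isTransitiveOrientation_eq_two_iff hconn hcomp huv x.1.2 (hne x)
  · have := finrank_topEigenspace_of_not_connected hGc
    omega
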